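/- Let $\mathfrak F$ be a complex Hilbert space, $H:\mathrm{dom}(H)\subseteq\mathfrak F\to\mathfrak F$ self-adjoint and bounded from below, and $\lambda_\circ\in\mathbb R$ with $\lambda_\circ<\inf\sigma(H)$. For $s\in[0,1]$ let $\mathfrak H_s=\mathrm{dom}((H^2+1)^{s/2})$ with norm $\|\psi\|_s=\|(H^2+1)^{s/2}\psi\|$, and let $\mathscr B(X,Y)$ denote the bounded linear operators from $X$ to $Y$. Write $\varrho(L)$ for the resolvent set of $L$, $R_z=(-H+z)^{-1}$ for $z\in\varrho(H)$, and $R=R_{\lambda_\circ}$. An operator $S$ is called $H$-small if $\mathrm{dom}(S)\supseteq\mathrm{dom}(H)$ and there are $a\in[0,1)$, $b\in\mathbb R$ with $\|S\psi\|\le a\|H\psi\|+b\|\psi\|$ for all $\psi\in\mathrm{dom}(H)$. **Lemma 4.1.** For $n\ge 1$ let $A_n:\mathrm{dom}(A_n)\subseteq\mathfrak F\to\mathfrak F$ be a closable operator such that $\mathrm{dom}(A_n)\supseteq\mathfrak H_{1/2}$, $A_n\in\mathscr B(\mathfrak H_{1/2},\mathfrak F)$ and $A_n^*+A_n$ is $H$-small,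 and let $E_n:\mathfrak F\to\mathfrak F$ be bounded and symmetric. Then $H_n:=H+A_n^*+A_n$ is self-adjoint with domain $\mathrm{dom}(H)=\mathfrak H_1$. For $z\in\varrho(H)$ put $$\mathbb A_n\psi:=A_n\psi\oplus\psi,\qquad G_{n,z}:=(A_nR_{\bar z})^*,\qquad \mathbb G_{n,z}:=(\mathbb A_nR_{\bar z})^*,\qquad G_n:=G_{n,\lambda_\circ},\qquad \mathbb G_n:=\mathbb G_{n,\lambda_\circ},$$ $$\mathbb M_{n,z}:=\mathbb A_n(\mathbb G_n-\mathbb G_{n,z}),\qquad \mathbb\Theta_n:=\begin{bmatrix}E_n-A_nRA_n^*&1-G_n^*\\ 1-G_n&-R\end{bmatrix},$$ where $A_nRA_n^*:=A_nG_n$. These operators are well defined and bounded between the following spaces, for every $s\in[0,1]$: $$\mathbb A_n\in\mathscr B(\mathfrak H_1,\mathfrak F\oplus\mathfrak H_1),\quad G_{n,z}\in\mathscr B(\mathfrak H_s),\quad \mathbb G_{n,z}\in\mathscr B(\mathfrak H_s\oplus\mathfrak F,\mathfrak H_s),\quad \mathbb G_{n,\bar z}^*\in\mathscr B(\mathfrak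 F,\mathfrak F\oplus\mathfrak H_1),$$ $$\mathbb M_{n,z}\in\mathscr B(\mathfrak F\oplus\mathfrak F,\mathfrak F\oplus\mathfrak H_1),\qquad \mathbb\Theta_n\in\mathscr B(\mathfrak H_s\oplus\mathfrak F,\mathfrak F\oplus\mathfrak H_s).$$ Moreover, for every $z\in\varrho(H)\cap\varrho(H_n-E_n)$ the operator $\mathbb\Theta_n+\mathbb M_{n,z}$ has an inverse on $\mathfrak F\oplus\mathfrak F$ which, for every $s\in[0,1]$, restricts to the inverse of $\mathbb\Theta_n+\mathbb M_{n,z}:\mathfrak H_s\oplus\mathfrak F\to\mathfrak F\oplus\mathfrak H_s$ and belongs to $\mathscr B(\mathfrak F\oplus\mathfrak H_s,\mathfrak H_s\oplus\mathfrak F)$, and $$(-(H_n-E_n)+z)^{-1}=R_z+\mathbb G_{n,z}\,(\mathbb\Theta_n+\mathbb M_{n,z})^{-1}\,\mathbb G_{n,\bar z}^{*}.$$ -/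

import Mathlib

noncomputable section

namespace Krein

open ComplexConjugate

section General

variable {V W X Y : Type*}
  [NormedAddCommGroup V] [NormedSpace ℂ V] [NormedAddCommGroup W] [NormedSpace ℂ W]
  [SeminormedAddCommGroup X] [NormedSpace ℂ X] [SeminormedAddCommGroup Y] [NormedSpace ℂ Y]

/-- `S` is the product `A T` of the partially defined operator `A` and the bounded operator `T`:
for every `f`, the vector `T f` lies in the domain of `A`, and `S f = A (T f)`. -/
def IsProduct (A : V →ₗ.[ℂ] W) (T : X →L[ℂ] V) (S : X →L[ℂ] W) : Prop :=
  ∀ f : X, (T f, S f) ∈ A.graph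

open Classical in
/-- The product `A T`, when it is everywhere defined and bounded (junk value `0` otherwise). -/
def product (A : V →ₗ.[ℂ] W) (T : X →L[ℂ] V) : X →L[ℂ] W :=
  if h : ∃ S : X →L[ℂ] W, IsProduct A T S then h.choose else 0

/-- Let `X` and `Y` be included in `V` and `W` through `ιX` and `ιY`. The operator `T : V → W` belongs
to `B(X, Y)`: it maps `X` into `Y`, and it is bounded with respect to the norms of `X` and `Y`. -/
def MemB (ιX : X →ₗ[ℂ] V) (ιY : Y →ₗ[ℂ] W) (T : V →L[ℂ] W) : Prop :=
  ∃ S : X →L[ℂ] Y, ∀ x : X, ιY (S x) = T (ιX x)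

/-- The same for an operator `A` that is only partially defined: `X` is contained in the domain of
`A`, `A` maps `X` into `Y`, and it is bounded with respect to the norms of `X` and `Y`. -/
def PMemB (ιX : X →ₗ[ℂ] V) (ιY : Y →ₗ[ℂ] W) (A : V →ₗ.[ℂ] W) : Prop :=
  ∃ S : X →L[ℂ] Y, ∀ x : X, (ιX x, ιY (S x)) ∈ A.graph

end General

variable {F : Type*} [NormedAddCommGroup F] [InnerProductSpace ℂ F] [CompleteSpace F]

/-- `R` is the resolvent `(-L + z)⁻¹`, a bounded two-sided inverse of `-L + z : dom(L) → F`. -/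
def IsResolvent (L : F →ₗ.[ℂ] F) (z : ℂ) (R : F →L[ℂ] F) : Prop :=
  (∀ f : F, ∃ h : R f ∈ L.domain, -L ⟨R f, h⟩ + z • R f = f) ∧
    ∀ ψ : L.domain, R (-L ψ + z • (ψ : F)) = ψ

/-- The resolvent set of `L`. -/
def resolventSet (L : F →ₗ.[ℂ] F) : Set ℂ := {z | ∃ R : F →L[ℂ] F, IsResolvent L z R}

open Classical in
/-- The resolvent `(-L + z)⁻¹` (junk value `0` outside the resolvent set). -/
def res (L : F →ₗ.[ℂ] F) (z : ℂ) : F →L[ℂ] F :=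
  if h : ∃ R : F →L[ℂ] F, IsResolvent L z R then h.choose else 0

/-- `L` is bounded from below. -/
def BoundedFromBelow (L : F →ₗ.[ℂ] F) : Prop :=
  ∃ c : ℝ, ∀ ψ : L.domain, c * ‖(ψ : F)‖ ^ 2 ≤ (inner ℂ (ψ : F) (L ψ)).re

/-- The infimum of the (real) spectrum of `L`; it is `⊤` if the spectrum is empty. -/
def infSpectrum (L : F →ₗ.[ℂ] F) : EReal :=
  sInf ((fun x : ℝ => (x : EReal)) '' {x : ℝ | (x : ℂ) ∉ resolventSet L})

/-- `S` is `H`-small (relatively bounded with respect to `H` with relative bound less than one). -/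
def IsSmall (H S : F →ₗ.[ℂ] F) : Prop :=
  ∃ hd : H.domain ≤ S.domain, ∃ a b : ℝ, 0 ≤ a ∧ a < 1 ∧
    ∀ ψ : H.domain, ‖S ⟨ψ, hd ψ.2⟩‖ ≤ a * ‖H ψ‖ + b * ‖(ψ : F)‖

/-- An everywhere defined bounded operator, seen as an operator with domain `⊤`. -/
def full (E : F →L[ℂ] F) : F →ₗ.[ℂ] F := (E : F →ₗ[ℂ] F).toPMap ⊤

/-! ### The scale of Hilbert spaces -/

/-- `(H² + 1)⁻¹`, obtained as `((-H + i)⁻¹)* (-H + i)⁻¹ = (-H - i)⁻¹ (-H + i)⁻¹` for a self-adjoint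
operator `H`. -/
def invSqAddOne (H : F →ₗ.[ℂ] F) : F →L[ℂ] F :=
  ContinuousLinearMap.adjoint (res H Complex.I) ∘L res H Complex.I

/-- `(H² + 1) ^ (s / 2)` for `0 ≤ s`, as the inverse of the fractional power
`((H² + 1)⁻¹) ^ (s / 2)` (continuous functional calculus) of a positive bounded operator. -/
def scalePower (H : F →ₗ.[ℂ] F) (s : ℝ) : F →ₗ.[ℂ] F :=
  (full (invSqAddOne H ^ (s / 2))).inverse

/-- The space `H_s`, `0 ≤ s`: the domain of `(H² + 1) ^ (s / 2)`, with the norm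
`‖ψ‖_s = ‖(H² + 1) ^ (s / 2) ψ‖`. -/
def Scale (H : F →ₗ.[ℂ] F) (s : ℝ) : Type _ := (scalePower H s).domain

instance (H : F →ₗ.[ℂ] F) (s : ℝ) : AddCommGroup (Scale H s) :=
  inferInstanceAs (AddCommGroup (scalePower H s).domain)

instance (H : F →ₗ.[ℂ] F) (s : ℝ) : Module ℂ (Scale H s) :=
  inferInstanceAs (Module ℂ (scalePower H s).domain)

/-- The map `ψ ↦ (H² + 1) ^ (s / 2) ψ` from `H_s` to `F`. -/
def Scale.pow (H : F →ₗ.[ℂ] F) (s : ℝ) : Scale H s →ₗ[ℂ] F := (scalePower H s).toFun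

/-- The inclusion of `H_s` in `F`. -/
def Scale.incl (H : F →ₗ.[ℂ] F) (s : ℝ) : Scale H s →ₗ[ℂ] F := (scalePower H s).domain.subtype

instance (H : F →ₗ.[ℂ] F) (s : ℝ) : SeminormedAddCommGroup (Scale H s) :=
  SeminormedAddCommGroup.induced (Scale H s) F (Scale.pow H s)

instance (H : F →ₗ.[ℂ] F) (s : ℝ) : NormedSpace ℂ (Scale H s) :=
  NormedSpace.induced ℂ (Scale H s) F (Scale.pow H s)

/-- The inclusion of `H_s ⊕ F` in `F ⊕ F`. -/
def inclLeft (H : F →ₗ.[ℂ] F) (s : ℝ) : WithLp 2 (Scale H s × F) →ₗ[ℂ] WithLp 2 (F × F) where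
  toFun x := WithLp.toLp 2 (Scale.incl H s x.fst, x.snd)
  map_add' x y := by simp [← WithLp.toLp_add]
  map_smul' c x := by simp [← WithLp.toLp_smul]

/-- The inclusion of `F ⊕ H_s` in `F ⊕ F`. -/
def inclRight (H : F →ₗ.[ℂ] F) (s : ℝ) : WithLp 2 (F × Scale H s) →ₗ[ℂ] WithLp 2 (F × F) where
  toFun x := WithLp.toLp 2 (x.fst, Scale.incl H s x.snd)
  map_add' x y := by simp [← WithLp.toLp_add]
  map_smul' c x := by simp [← WithLp.toLp_smul]

/-! ### The operators of the resolvent formula -/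

/-- The operator `A ψ ⊕ ψ` from `dom(A) ⊆ F` to `F ⊕ F`. -/
def double (A : F →ₗ.[ℂ] F) : F →ₗ.[ℂ] WithLp 2 (F × F) where
  domain := A.domain
  toFun :=
    { toFun := fun ψ => WithLp.toLp 2 (A ψ, (ψ : F))
      map_add' := fun x y => by simp [← WithLp.toLp_add, LinearPMap.map_add]
      map_smul' := fun c x => by simp [← WithLp.toLp_smul, LinearPMap.map_smul] }

/-- The block operator matrix with rows `(a, b)` and `(c, d)` acting in `F ⊕ F`. -/
def block (a b c d : F →L[ℂ] F) : WithLp 2 (F × F) →L[ℂ] WithLp 2 (F × F) :=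
  (WithLp.prodContinuousLinearEquiv 2 ℂ F F).symm.toContinuousLinearMap ∘L
    (((a ∘L ContinuousLinearMap.fst ℂ F F + b ∘L ContinuousLinearMap.snd ℂ F F).prod
      (c ∘L ContinuousLinearMap.fst ℂ F F + d ∘L ContinuousLinearMap.snd ℂ F F)) ∘L
    (WithLp.prodContinuousLinearEquiv 2 ℂ F F).toContinuousLinearMap)

/-- `G_z = (A R_{z̄})*`. Through the pairing between `H_{-1}` and `H_1`, it is also `R_z A*`. -/
def G (H A : F →ₗ.[ℂ] F) (z : ℂ) : F →L[ℂ] F :=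
  ContinuousLinearMap.adjoint (product A (res H (conj z)))

/-- `𝔾_z = (𝔸 R_{z̄})*`, where `𝔸 ψ = A ψ ⊕ ψ`. -/
def GG (H A : F →ₗ.[ℂ] F) (z : ℂ) : WithLp 2 (F × F) →L[ℂ] F :=
  ContinuousLinearMap.adjoint (product (double A) (res H (conj z)))

/-- `A R A*` with `R = R_l`, where `R A* = G_l`. -/
def ARA (H A : F →ₗ.[ℂ] F) (l : ℝ) : F →L[ℂ] F := product A (G H A l)

/-- `𝕄_z = 𝔸 (𝔾_l - 𝔾_z)`. -/
def MM (H A : F →ₗ.[ℂ] F) (l : ℝ) (z : ℂ) : WithLp 2 (F × F) →L[ℂ] WithLp 2 (F × F) :=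
  product (double A) (GG H A l - GG H A z)

/-- The block operator matrix with rows `(E - A R A*, 1 - G_l*)` and `(1 - G_l, -R_l)`. -/
def Theta (H A : F →ₗ.[ℂ] F) (E : F →L[ℂ] F) (l : ℝ) :
    WithLp 2 (F × F) →L[ℂ] WithLp 2 (F × F) :=
  block (E - ARA H A l) (1 - ContinuousLinearMap.adjoint (G H A l)) (1 - G H A l) (-res H l)

end Krein

end

noncomputable section

namespace Krein

open ComplexConjugate

set_option linter.unusedSectionVars false

variable {F : Type*} [NormedAddCommGroup F] [InnerProductSpace ℂ F] [CompleteSpace F]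

/-! ### Self-adjoint operators and their resolvents -/

/-! The resolvent formula is a Woodbury identity. Formally `A* + A - E = U C U*` with the row `U =
(A*, 1)`, the column `U* = (A, 1)` and `C` with rows `(0, 1)`, `(1, -E)`. The inverse of `C` has
rows `(E, 1)`, `(1, 0)`, and `Θ + 𝕄_z = C⁻¹ - U* R_z U`; the reference point `l` cancels. With `Q`
the resolvent of the perturbed operator, the inverse is `K = C + C U* Q U C`. It is written down
explicitly and checked in `block_inverse`, using only the second resolvent identity in both orders
and its images under taking adjoints and applying `A`.

Two points make this rigorous. First, self-adjointness of the perturbed operators is Kato–Rellich,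
applied to the `H`-small part and then to the bounded part. Second, `A R A*` must be bounded. A
resolvent factors as `q W q` with `q = (H² + 1)^{-1/4}` (`exists_res_eq_sandwich`), and `B = A q` is
bounded by hypothesis, so `A R A*` means `B W B*`. The same is needed for the perturbed operator
`M`; as `dom(M) = dom(H)`, interpolation puts `M`'s space of order `1/2` inside that of `H`.

The mapping properties on `H_s` also come from interpolation (`exists_interpolation`): an operator
bounded on `F` that maps `dom(H)` into itself preserves every `H_s`. This applies to `G_z`, which
equals `R_z A*` on `dom(A*) ⊇ dom(H)`. The interpolation rests on the operator inequality
`re_inner_rpow_le`, together with Douglas factorization. -/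

lemma mem_adjoint_graph_iff {A : F →ₗ.[ℂ] F} (hA : Dense (A.domain : Set F)) {x y : F} :
    (x, y) ∈ A.adjoint.graph ↔ ∀ a b, (a, b) ∈ A.graph → inner ℂ b x = inner ℂ a y := by
  rw [LinearPMap.adjoint_graph_eq_graph_adjoint hA, Submodule.mem_adjoint_iff]
  simp only [sub_eq_zero]

lemma mem_graph_iff_of_isSelfAdjoint {L : F →ₗ.[ℂ] F} (hL : IsSelfAdjoint L) {x y : F} :
    (x, y) ∈ L.graph ↔ ∀ a b, (a, b) ∈ L.graph → inner ℂ b x = inner ℂ a y := by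
  rw [← mem_adjoint_graph_iff hL.dense_domain, LinearPMap.isSelfAdjoint_def.1 hL]

/-- Graph membership avoids proofs of domain membership inside terms; later arguments use this form.
-/
lemma isResolvent_iff {L : F →ₗ.[ℂ] F} {z : ℂ} {R : F →L[ℂ] F} :
    IsResolvent L z R ↔
      (∀ f, (R f, z • R f - f) ∈ L.graph) ∧ ∀ x y, (x, y) ∈ L.graph → R (z • x - y) = x := by
  refine and_congr (forall_congr' fun f => ?_) ⟨fun h x y hxy => ?_, fun h ψ => ?_⟩
  · constructor
    · rintro ⟨h, hf⟩
      have : L ⟨R f, h⟩ = z • R f - f := by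
        have h3 := eq_sub_of_add_eq hf
        rw [← neg_sub, ← h3, neg_neg]
      rw [← this]
      exact L.mem_graph ⟨R f, h⟩
    · intro h
      obtain ⟨ψ, h1, h2⟩ := (LinearPMap.mem_graph_iff L).1 h
      simp only at h1 h2
      refine ⟨h1 ▸ ψ.2, ?_⟩
      have : (⟨R f, h1 ▸ ψ.2⟩ : L.domain) = ψ := Subtype.ext h1.symm
      rw [this, h2]
      abel
  · obtain ⟨ψ, rfl, rfl⟩ := (LinearPMap.mem_graph_iff L).1 hxy
    rw [← h ψ]
    congr 1
    simp only [h ψ]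
    abel
  · rw [← h _ _ (L.mem_graph ψ)]
    congr 1
    rw [h _ _ (L.mem_graph ψ)]
    abel

lemma isResolvent_res {L : F →ₗ.[ℂ] F} {z : ℂ} (hz : z ∈ resolventSet L) :
    IsResolvent L z (res L z) := by
  have h : ∃ R : F →L[ℂ] F, IsResolvent L z R := hz
  rw [res, dif_pos h]
  exact h.choose_spec

section Resolvent

variable {L : F →ₗ.[ℂ] F} {z w : ℂ}

lemma res_mem_graph (hz : z ∈ resolventSet L) (f : F) :
    (res L z f, z • res L z f - f) ∈ L.graph :=
  (isResolvent_iff.1 (isResolvent_res hz)).1 f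

lemma res_mem_domain (hz : z ∈ resolventSet L) (f : F) : res L z f ∈ L.domain :=
  LinearPMap.mem_domain_of_mem_graph (res_mem_graph hz f)

lemma res_sub (hz : z ∈ resolventSet L) {x y : F} (h : (x, y) ∈ L.graph) :
    res L z (z • x - y) = x :=
  (isResolvent_iff.1 (isResolvent_res hz)).2 x y h

lemma res_eq (hz : z ∈ resolventSet L) {R : F →L[ℂ] F} (hR : IsResolvent L z R) :
    res L z = R := by
  ext f
  have := res_sub hz ((isResolvent_iff.1 hR).1 f)
  rwa [sub_sub_cancel] at this

lemma res_injective (hz : z ∈ resolventSet L) : Function.Injective (res L z) := by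
  refine (injective_iff_map_eq_zero _).2 fun f hf => ?_
  have h := res_mem_graph hz f
  rw [hf, smul_zero, zero_sub] at h
  exact neg_eq_zero.1 (L.graph_fst_eq_zero_snd h rfl)

lemma exists_res_eq (hz : z ∈ resolventSet L) {x : F} (hx : x ∈ L.domain) :
    ∃ f, res L z f = x :=
  ⟨z • x - L ⟨x, hx⟩, res_sub hz (L.mem_graph ⟨x, hx⟩)⟩

/-- The first resolvent identity. -/
lemma res_sub_res (hz : z ∈ resolventSet L) (hw : w ∈ resolventSet L) :
    res L z - res L w = (w - z) • (res L z ∘L res L w) := by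
  ext f
  have h := res_sub hz (res_mem_graph hw f)
  have h2 : z • res L w f - (w • res L w f - f) = f - (w - z) • res L w f := by
    rw [sub_smul]; abel
  rw [h2, map_sub, map_smul] at h
  simp only [sub_apply, smul_apply,
    ContinuousLinearMap.comp_apply]
  exact sub_eq_iff_eq_add'.2 (sub_eq_iff_eq_add.1 h)

lemma res_commute (hz : z ∈ resolventSet L) (hw : w ∈ resolventSet L) :
    Commute (res L z) (res L w) := by
  rcases eq_or_ne z w with rfl | hne
  · exact Commute.refl _
  have h1 := res_sub_res hz hw
  have h2 := res_sub_res hw hz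
  have h3 : (w - z) • (res L z ∘L res L w) = (w - z) • (res L w ∘L res L z) := by
    rw [← h1, ← neg_sub (res L w), h2, ← neg_smul, neg_sub]
  exact smul_right_injective _ (sub_ne_zero.2 hne.symm) h3

lemma isResolvent_adjoint (hL : IsSelfAdjoint L) (hz : z ∈ resolventSet L) :
    IsResolvent L (conj z) (ContinuousLinearMap.adjoint (res L z)) := by
  refine isResolvent_iff.2 ⟨fun f => ?_, fun x y h => ?_⟩
  · refine (mem_graph_iff_of_isSelfAdjoint hL).2 fun a b hab => ?_
    have h := res_sub hz hab
    have h2 : inner ℂ (z • a - b) (ContinuousLinearMap.adjoint (res L z) f) = inner ℂ a f := by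
      rw [ContinuousLinearMap.adjoint_inner_right, h]
    rw [inner_sub_left, inner_smul_left, sub_eq_iff_eq_add] at h2
    rw [inner_sub_right, inner_smul_right, h2]
    ring
  · refine ext_inner_left ℂ fun f => ?_
    rw [ContinuousLinearMap.adjoint_inner_right]
    have h2 := (mem_graph_iff_of_isSelfAdjoint hL).1 h _ _ (res_mem_graph hz f)
    rw [inner_sub_left, inner_smul_left, sub_eq_iff_eq_add] at h2
    rw [inner_sub_right, inner_smul_right, h2]
    ring

lemma conj_mem_resolventSet (hL : IsSelfAdjoint L) (hz : z ∈ resolventSet L) :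
    conj z ∈ resolventSet L :=
  ⟨_, isResolvent_adjoint hL hz⟩

lemma res_conj (hL : IsSelfAdjoint L) (hz : z ∈ resolventSet L) :
    res L (conj z) = ContinuousLinearMap.adjoint (res L z) :=
  res_eq (conj_mem_resolventSet hL hz) (isResolvent_adjoint hL hz)

lemma mem_resolventSet_of_lt_infSpectrum {l : ℝ} (hl : (l : EReal) < infSpectrum L) :
    (l : ℂ) ∈ resolventSet L := by
  by_contra h
  exact (not_le.2 hl) (sInf_le ⟨l, h, rfl⟩)

/-- The map `(x, y) ↦ z x - y` on the graph of `L`. -/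
def graphSub (L : F →ₗ.[ℂ] F) (z : ℂ) : L.graph →L[ℂ] F :=
  (z • ContinuousLinearMap.fst ℂ F F - ContinuousLinearMap.snd ℂ F F) ∘L L.graph.subtypeL

/-- The graph of a closed operator is a Banach space, so the open mapping theorem bounds the
inverse. -/
lemma mem_resolventSet_of_bijective (hL : L.IsClosed)
    (hinj : Function.Injective (graphSub L z)) (hsurj : Function.Surjective (graphSub L z)) :
    z ∈ resolventSet L := by
  have : CompleteSpace L.graph := hL.completeSpace_coe
  let e := ContinuousLinearEquiv.ofBijective (graphSub L z) (LinearMap.ker_eq_bot.2 hinj)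
    (LinearMap.range_eq_top.2 hsurj)
  have he : ∀ f, z • ((e.symm f : F × F)).1 - ((e.symm f : F × F)).2 = f :=
    fun f => e.apply_symm_apply f
  refine ⟨ContinuousLinearMap.fst ℂ F F ∘L L.graph.subtypeL ∘L e.symm.toContinuousLinearMap,
    isResolvent_iff.2 ⟨fun f => ?_, fun x y h => ?_⟩⟩
  · have h2 : z • ((e.symm f : F × F)).1 - f = ((e.symm f : F × F)).2 := by
      nth_rewrite 2 [← he f]; abel
    change ((e.symm f : F × F).1, z • (e.symm f : F × F).1 - f) ∈ L.graph
    rw [h2]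
    exact (e.symm f).2
  · have : e.symm (z • x - y) = ⟨(x, y), h⟩ := e.symm_apply_apply ⟨(x, y), h⟩
    change (e.symm (z • x - y) : F × F).1 = x
    rw [this]

end Resolvent

/-! ### Non-real points of the resolvent set and the Kato–Rellich theorem -/

section Symmetric

variable {L : F →ₗ.[ℂ] F}

lemma im_inner_graph_eq_zero (hL : IsSelfAdjoint L) {x y : F} (h : (x, y) ∈ L.graph) :
    (inner ℂ x y).im = 0 := by
  have h1 := (mem_graph_iff_of_isSelfAdjoint hL).1 h x y h
  have h2 := inner_conj_symm (𝕜 := ℂ) x y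
  rw [h1] at h2
  exact Complex.conj_eq_iff_im.1 h2

/-- Since `⟨x, y⟩` is real, the imaginary part of `⟨x, z x - y⟩` is `Im z ‖x‖²`; Cauchy–Schwarz does
the rest. -/
lemma abs_im_mul_norm_le (hL : IsSelfAdjoint L) {x y : F} (h : (x, y) ∈ L.graph) (z : ℂ) :
    |z.im| * ‖x‖ ≤ ‖z • x - y‖ := by
  rcases eq_or_ne x 0 with rfl | hx
  · simp
  have h1 : (inner ℂ x (z • x - y)).im = z.im * ‖x‖ ^ 2 := by
    rw [inner_sub_right, inner_smul_right, Complex.sub_im, im_inner_graph_eq_zero hL h,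
      inner_self_eq_norm_sq_to_K]
    simp [← Complex.ofReal_pow]
  have h2 : |z.im| * ‖x‖ ^ 2 ≤ ‖x‖ * ‖z • x - y‖ := by
    rw [← abs_of_nonneg (sq_nonneg ‖x‖), ← abs_mul, ← h1]
    exact (Complex.abs_im_le_norm _).trans (norm_inner_le_norm _ _)
  have h3 : 0 < ‖x‖ := norm_pos_iff.2 hx
  nlinarith

/-- The estimate `abs_im_mul_norm_le` makes `z - L` bounded below in the graph norm, hence injective
with closed range. The same estimate at `conj z` shows that the range has trivial orthogonal
complement. -/
lemma mem_resolventSet_of_im_ne_zero (hL : IsSelfAdjoint L) {z : ℂ} (hz : z.im ≠ 0) :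
    z ∈ resolventSet L := by
  have hpos : 0 < |z.im| := abs_pos.2 hz
  have hcl : CompleteSpace L.graph := hL.isClosed.completeSpace_coe
  have hbd : ∀ v : L.graph, ‖v‖ ≤ (1 + (‖z‖ + 1) * |z.im|⁻¹) * ‖graphSub L z v‖ := by
    rintro ⟨⟨x, y⟩, h⟩
    have h1 := abs_im_mul_norm_le hL h z
    have h2 : ‖y‖ ≤ ‖z‖ * ‖x‖ + ‖z • x - y‖ := by
      rw [← norm_smul]
      calc ‖y‖ = ‖z • x - (z • x - y)‖ := by rw [sub_sub_cancel]
        _ ≤ _ := norm_sub_le _ _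
    have h3 : ‖x‖ ≤ |z.im|⁻¹ * ‖z • x - y‖ := by
      rw [inv_mul_eq_div, le_div_iff₀ hpos, mul_comm]; exact h1
    change max ‖x‖ ‖y‖ ≤ (1 + (‖z‖ + 1) * |z.im|⁻¹) * ‖z • x - y‖
    have h4 := mul_le_mul_of_nonneg_left h3 (norm_nonneg z)
    have h5 := norm_nonneg (z • x - y)
    have h6 : 0 ≤ ‖z‖ * ‖x‖ := by positivity
    refine max_le ?_ ?_ <;> nlinarith [norm_nonneg x]
  have hanti : AntilipschitzWith (Real.toNNReal (1 + (‖z‖ + 1) * |z.im|⁻¹)) (graphSub L z) := by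
    refine AddMonoidHomClass.antilipschitz_of_bound _ fun v => ?_
    rw [Real.coe_toNNReal _ (by positivity)]
    exact hbd v
  refine mem_resolventSet_of_bijective hL.isClosed hanti.injective ?_
  have hrange : IsClosed (Set.range (graphSub L z)) :=
    hanti.isClosed_range (graphSub L z).uniformContinuous
  have hrange' : IsClosed
      ((LinearMap.range (graphSub L z : L.graph →ₗ[ℂ] F) : Submodule ℂ F) : Set F) := by
    rw [LinearMap.coe_range]
    exact hrange
  have : CompleteSpace (LinearMap.range (graphSub L z : L.graph →ₗ[ℂ] F)) :=
    hrange'.completeSpace_coe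
  refine LinearMap.range_eq_top.1 ((Submodule.orthogonal_eq_bot_iff
    (K := LinearMap.range (graphSub L z : L.graph →ₗ[ℂ] F))).1 ?_)
  refine (Submodule.eq_bot_iff _).2 fun v hv => ?_
  -- Orthogonality to the range of `z - L` makes `v` an eigenvector of `L* = L` for `conj z`.
  have hv2 : (v, conj z • v) ∈ L.graph := by
    refine (mem_graph_iff_of_isSelfAdjoint hL).2 fun a b hab => ?_
    have := (Submodule.mem_orthogonal _ _).1 hv (z • a - b) ⟨⟨(a, b), hab⟩, rfl⟩
    rw [inner_sub_left, inner_smul_left, sub_eq_zero] at this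
    rw [inner_smul_right, this]
  have := abs_im_mul_norm_le hL hv2 (conj z)
  rw [sub_self, norm_zero, Complex.conj_im, abs_neg] at this
  exact norm_le_zero_iff.1 (nonpos_of_mul_nonpos_right this hpos)

/-- Subtract from a point of the adjoint's graph a point of `L` with the same image under `z - ·`.
The difference is orthogonal to the range of `conj z - L`, which is everything. -/
lemma isSelfAdjoint_of_surjective (hd : Dense (L.domain : Set F))
    (hsymm : ∀ x y a b, (x, y) ∈ L.graph → (a, b) ∈ L.graph → inner ℂ b x = inner ℂ a y)
    {z : ℂ} (hz : ∀ f, ∃ x y, (x, y) ∈ L.graph ∧ z • x - y = f)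
    (hz' : ∀ f, ∃ x y, (x, y) ∈ L.graph ∧ conj z • x - y = f) : IsSelfAdjoint L := by
  refine LinearPMap.isSelfAdjoint_def.2 (LinearPMap.eq_of_eq_graph (le_antisymm ?_ ?_))
  · rintro ⟨x, y⟩ h
    obtain ⟨x₁, y₁, h₁, he⟩ := hz (z • x - y)
    rw [mem_adjoint_graph_iff hd] at h
    have hd0 : x - x₁ = 0 := by
      obtain ⟨a, b, hab, hf⟩ := hz' (x - x₁)
      rw [← inner_self_eq_zero (𝕜 := ℂ)]
      nth_rewrite 1 [← hf]
      have e1 := h a b hab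
      have e2 := hsymm x₁ y₁ a b h₁ hab
      have e3 : y - y₁ = z • (x - x₁) := by
        rw [smul_sub, sub_eq_sub_iff_add_eq_add]
        rw [sub_eq_sub_iff_add_eq_add] at he
        rw [add_comm y, he]
      rw [inner_sub_left, inner_smul_left, inner_sub_right b, e1, e2, ← inner_sub_right, e3,
        inner_smul_right]
      simp
    have hx : x = x₁ := sub_eq_zero.1 hd0
    rw [hx] at he ⊢
    rwa [← sub_right_injective he]
  · rintro ⟨x, y⟩ h
    exact (mem_adjoint_graph_iff hd).2 fun a b hab => hsymm x y a b h hab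

lemma norm_sq_smul_sub (hL : IsSelfAdjoint L) {x y : F} (h : (x, y) ∈ L.graph) {z : ℂ}
    (hz : z.re = 0) : ‖z • x - y‖ ^ 2 = z.im ^ 2 * ‖x‖ ^ 2 + ‖y‖ ^ 2 := by
  rw [@norm_sub_sq ℂ, norm_smul, mul_pow, Complex.sq_norm, Complex.normSq_apply, hz,
    inner_smul_left]
  have := im_inner_graph_eq_zero hL h
  simp only [RCLike.re_to_complex, Complex.mul_re, Complex.conj_re, Complex.conj_im, hz, this]
  ring

/-- The Kato–Rellich theorem. -/
lemma isSelfAdjoint_of_relatively_bounded {K : F →ₗ.[ℂ] F} (hL : IsSelfAdjoint L)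
    (hdom : K.domain = L.domain)
    (hsymm : ∀ x y a b, (x, y) ∈ K.graph → (a, b) ∈ K.graph → inner ℂ b x = inner ℂ a y)
    {a b : ℝ} (ha0 : 0 ≤ a) (ha : a < 1)
    (hab : ∀ x y y', (x, y) ∈ L.graph → (x, y') ∈ K.graph → ‖y' - y‖ ≤ a * ‖y‖ + b * ‖x‖) :
    IsSelfAdjoint K := by
  -- At `z = ±iμ` one has `‖L R_z‖ ≤ 1` and `‖R_z‖ ≤ 1 / μ`, so `a + |b| / μ` bounds `(K - L) R_z`.
  obtain ⟨μ, hμ0, hμ⟩ : ∃ μ : ℝ, 0 < μ ∧ a + |b| / μ < 1 := by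
    refine ⟨(|b| + 1) / (1 - a), by have := abs_nonneg b; have : 0 < 1 - a := by linarith
                                    positivity, ?_⟩
    have h1 : 0 < 1 - a := by linarith
    rw [div_div_eq_mul_div, ← lt_sub_iff_add_lt', div_lt_iff₀ (by positivity)]
    nlinarith [abs_nonneg b]
  have key : ∀ z : ℂ, z.re = 0 → z.im ^ 2 = μ ^ 2 →
      ∀ f, ∃ x y, (x, y) ∈ K.graph ∧ z • x - y = f := by
    intro z hz hzμ
    have hzr : z ∈ resolventSet L := mem_resolventSet_of_im_ne_zero hL fun h => by
      rw [h] at hzμ; nlinarith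
    have hK : ∀ f, res L z f ∈ K.domain := fun f => hdom ▸ res_mem_domain hzr f
    -- This is `(K - L) R_z`. Since `z - K = (1 - D) (z - L)`, a Neumann series gives surjectivity.
    let D₀ : F →ₗ[ℂ] F := K.toFun ∘ₗ (res L z : F →ₗ[ℂ] F).codRestrict K.domain hK -
      (z • (res L z : F →ₗ[ℂ] F) - LinearMap.id)
    have hD₀ : ∀ f, D₀ f = K ⟨res L z f, hK f⟩ - (z • res L z f - f) := fun f => rfl
    have hbd : ∀ f, ‖D₀ f‖ ≤ (a + |b| / μ) * ‖f‖ := by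
      intro f
      have h := res_mem_graph hzr f
      have h1 := hab _ _ _ h (K.mem_graph ⟨res L z f, hK f⟩)
      have h2 := norm_sq_smul_sub hL h hz
      rw [sub_sub_cancel, hzμ] at h2
      have h3 : ‖z • res L z f - f‖ ≤ ‖f‖ := by
        refine abs_le_of_sq_le_sq' ?_ (norm_nonneg f) |>.2
        nlinarith [mul_nonneg (sq_nonneg μ) (sq_nonneg ‖res L z f‖)]
      have h4 : ‖res L z f‖ ≤ ‖f‖ / μ := by
        rw [le_div_iff₀ hμ0]
        refine abs_le_of_sq_le_sq' ?_ (norm_nonneg f) |>.2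
        nlinarith [sq_nonneg ‖z • res L z f - f‖]
      calc ‖D₀ f‖ ≤ a * ‖z • res L z f - f‖ + b * ‖res L z f‖ := h1
        _ ≤ a * ‖f‖ + |b| * (‖f‖ / μ) := by
          gcongr
          exact le_abs_self b
        _ = _ := by ring
    let D : F →L[ℂ] F := D₀.mkContinuous _ hbd
    have hD : ‖D‖ < 1 := (LinearMap.mkContinuous_norm_le _ (by positivity) _).trans_lt hμ
    obtain ⟨u, hu⟩ := isUnit_one_sub_of_norm_lt_one hD
    intro f
    have hf : (1 - D) (((u⁻¹ : (F →L[ℂ] F)ˣ) : F →L[ℂ] F) f) = f := by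
      rw [← hu, ← mul_apply_eq_comp, Units.mul_inv]; rfl
    set g := ((u⁻¹ : (F →L[ℂ] F)ˣ) : F →L[ℂ] F) f
    refine ⟨_, _, K.mem_graph ⟨res L z g, hK g⟩, ?_⟩
    have h2 : (1 - D) g = g - (K ⟨res L z g, hK g⟩ - (z • res L z g - g)) := rfl
    rw [← hf, h2]
    simp only
    abel
  refine isSelfAdjoint_of_surjective (hdom ▸ hL.dense_domain) hsymm
    (key (μ * Complex.I) (by simp) (by simp)) (key _ (by simp) (by simp))

end Symmetric

/-! ### Factorization of bounded operators -/

/-- One form of Douglas's lemma: injectivity of `S` determines the factor, and the closed graph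
theorem bounds it. -/
lemma exists_factor_of_range_le {T S : F →L[ℂ] F} (hS : Function.Injective S)
    (h : ∀ x, ∃ y, S y = T x) : ∃ C : F →L[ℂ] F, T = S ∘L C := by
  choose c hc using h
  let C₀ : F →ₗ[ℂ] F :=
    { toFun := c
      map_add' := fun x y => hS (by simp [hc])
      map_smul' := fun r x => hS (by simp [hc]) }
  have hC₀ : ∀ x, S (C₀ x) = T x := hc
  refine ⟨ContinuousLinearMap.ofSeqClosedGraph (g := C₀) fun u x y hu hCu => ?_, ?_⟩
  · refine hS (tendsto_nhds_unique ((S.continuous.tendsto y).comp hCu) ?_)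
    rw [hC₀]
    exact ((T.continuous.tendsto x).comp hu).congr fun n => (hC₀ (u n)).symm
  · ext x
    exact (hc x).symm

/-- The other form of Douglas's lemma. The map `P f ↦ S f` is bounded on the range of `P`, which is
dense because `P*` is injective; extend it and take adjoints. -/
lemma exists_factor_of_norm_le {P S : F →L[ℂ] F} (hinj : Function.Injective P)
    (hinj' : Function.Injective (ContinuousLinearMap.adjoint P)) {c : ℝ}
    (h : ∀ f, ‖S f‖ ≤ c * ‖P f‖) :
    ∃ C : F →L[ℂ] F, ContinuousLinearMap.adjoint S = ContinuousLinearMap.adjoint P ∘L C := by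
  let e := LinearEquiv.ofInjective (P : F →ₗ[ℂ] F) hinj
  have he : ∀ y, P (e.symm y) = y := fun y =>
    congrArg Subtype.val (e.apply_symm_apply y)
  let D₀ : LinearMap.range (P : F →ₗ[ℂ] F) →L[ℂ] F :=
    ((S : F →ₗ[ℂ] F) ∘ₗ (e.symm : _ →ₗ[ℂ] F)).mkContinuous c fun y => by
      refine (h _).trans ?_
      rw [LinearEquiv.coe_coe, he]
      rfl
  have hdense : DenseRange (Submodule.subtypeL (LinearMap.range (P : F →ₗ[ℂ] F))) := by
    have h1 : (LinearMap.range (P : F →ₗ[ℂ] F))ᗮ = ⊥ := by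
      refine (Submodule.eq_bot_iff _).2 fun v hv => hinj' ?_
      rw [map_zero, ← inner_self_eq_zero (𝕜 := ℂ), ContinuousLinearMap.adjoint_inner_right]
      exact (Submodule.mem_orthogonal _ _).1 hv _ ⟨_, rfl⟩
    have h2 := (Submodule.topologicalClosure_eq_top_iff).2 h1
    have h3 : Dense ((LinearMap.range (P : F →ₗ[ℂ] F) : Submodule ℂ F) : Set F) :=
      (Submodule.dense_iff_topologicalClosure_eq_top).2 h2
    exact h3.denseRange_val
  let D : F →L[ℂ] F := D₀.extend (Submodule.subtypeL _)
  have hD : S = D ∘L P := by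
    ext f
    have h1 := ContinuousLinearMap.extend_eq (e := Submodule.subtypeL _) D₀ hdense
      isUniformEmbedding_subtype_val.isUniformInducing ⟨P f, f, rfl⟩
    have h2 : D₀ ⟨P f, f, rfl⟩ = S f := congrArg S (e.symm_apply_apply f)
    exact (h1.trans h2).symm
  refine ⟨ContinuousLinearMap.adjoint D, ?_⟩
  rw [hD, ContinuousLinearMap.adjoint_comp]

/-! ### Fractional powers of bounded positive operators -/

section Powers

variable {a b : F →L[ℂ] F}

/-- Nonnegative exponents keep the functions continuous at `0`, so `a` need not be invertible. -/
lemma rpow_add_of_nonneg (a : F →L[ℂ] F) {x y : ℝ} (hx : 0 ≤ x) (hy : 0 ≤ y) :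
    a ^ (x + y) = a ^ x * a ^ y := by
  rw [CFC.rpow_def, CFC.rpow_def, CFC.rpow_def, ← cfc_mul _ _ a
    (NNReal.continuous_rpow_const hx).continuousOn (NNReal.continuous_rpow_const hy).continuousOn]
  exact cfc_congr fun r _ => NNReal.rpow_add_of_nonneg r hx hy

lemma isSelfAdjoint_rpow (a : F →L[ℂ] F) (x : ℝ) : IsSelfAdjoint (a ^ x) :=
  IsSelfAdjoint.of_nonneg CFC.rpow_nonneg

lemma adjoint_rpow (a : F →L[ℂ] F) (x : ℝ) : ContinuousLinearMap.adjoint (a ^ x) = a ^ x :=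
  (isSelfAdjoint_rpow a x).adjoint_eq

lemma rpow_injective (ha : 0 ≤ a) (hinj : Function.Injective a) {x : ℝ} (hx : 0 ≤ x) :
    Function.Injective (a ^ x) := by
  obtain ⟨n, hn⟩ := exists_nat_ge x
  have h1 : a ^ (n - x) * a ^ x = a ^ n := by
    rw [← rpow_add_of_nonneg a (by linarith) hx, sub_add_cancel, CFC.rpow_natCast a n ha]
  have h2 : Function.Injective (a ^ n) := by
    have h3 : ∀ n : ℕ, Function.Injective (a ^ n) := fun n => by
      induction n with
      | zero => exact Function.injective_id
      | succ n ih => rw [pow_succ]; exact ih.comp hinj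
    exact h3 n
  refine Function.Injective.of_comp (f := a ^ ((n : ℝ) - x)) ?_
  change Function.Injective (a ^ ((n : ℝ) - x) * a ^ x : F →L[ℂ] F)
  rwa [h1]

lemma re_inner_rpow (a : F →L[ℂ] F) {s : ℝ} (hs : 0 ≤ s) (f : F) :
    (inner ℂ f ((a ^ s) f)).re = ‖(a ^ (s / 2)) f‖ ^ 2 := by
  have h : a ^ s = a ^ (s / 2) * a ^ (s / 2) := by
    rw [← rpow_add_of_nonneg a (by linarith) (by linarith), add_halves]
  rw [h, mul_apply_eq_comp, ← ContinuousLinearMap.adjoint_inner_left, adjoint_rpow,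
    inner_self_eq_norm_sq_to_K]
  simp [← Complex.ofReal_pow]

/-- With `g = (a + t) w`, the quadratic form of `t a (a + t)⁻¹` at `g` is at most
`⟨k, a k⟩ + t ‖g - k‖²` for every `k`. -/
lemma parallel_sum_le (ha : 0 ≤ a) {t : ℝ} (ht : 0 < t) (w k : F) :
    t * (inner ℂ (a w + (t : ℂ) • w) (a w)).re ≤
      (inner ℂ k (a k)).re + t * ‖a w + (t : ℂ) • w - k‖ ^ 2 := by
  -- Relative to the minimizer `t w`, the excess of the right side is `⟨e, a e⟩ + t ‖e‖² ≥ 0`.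
  obtain ⟨e, rfl⟩ : ∃ e, k = (t : ℂ) • w + e := ⟨k - (t : ℂ) • w, by abel⟩
  have hsa : IsSelfAdjoint a := IsSelfAdjoint.of_nonneg ha
  have hpos : 0 ≤ (inner ℂ e (a e)).re :=
    ((ContinuousLinearMap.nonneg_iff_isPositive a).1 ha).re_inner_nonneg_right e
  have h1 : inner ℂ w (a e) = inner ℂ (a w) e := by
    rw [← ContinuousLinearMap.adjoint_inner_left, hsa.adjoint_eq]
  have h2 : (inner ℂ e (a w)).re = (inner ℂ (a w) e).re := by
    rw [← inner_conj_symm, Complex.conj_re]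
  have h3 : a w + (t : ℂ) • w - ((t : ℂ) • w + e) = a w - e := by abel
  have h4 : (inner ℂ (a w) (a w)).re = ‖a w‖ ^ 2 := by
    rw [inner_self_eq_norm_sq_to_K]; simp [← Complex.ofReal_pow]
  rw [h3, @norm_sub_sq ℂ]
  simp only [map_add, map_smul, inner_add_left, inner_add_right, inner_smul_left, inner_smul_right,
    Complex.add_re, Complex.conj_ofReal, Complex.re_ofReal_mul, h1, h2, h4, RCLike.re_to_complex]
  nlinarith [mul_nonneg ht.le (sq_nonneg ‖e‖)]

/-- Equality holds in `parallel_sum_le` for `k = t w`. -/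
lemma parallel_sum_eq (a : F →L[ℂ] F) (t : ℝ) (w : F) :
    t * (inner ℂ (a w + (t : ℂ) • w) (a w)).re =
      (inner ℂ ((t : ℂ) • w) (a ((t : ℂ) • w))).re +
        t * ‖a w + (t : ℂ) • w - (t : ℂ) • w‖ ^ 2 := by
  have h4 : (inner ℂ (a w) (a w)).re = ‖a w‖ ^ 2 := by
    rw [inner_self_eq_norm_sq_to_K]; simp [← Complex.ofReal_pow]
  simp only [add_sub_cancel_right, map_smul, inner_add_left, inner_smul_left, inner_smul_right,
    Complex.add_re, Complex.conj_ofReal, Complex.re_ofReal_mul, h4]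
  ring

/-- Here `v = (a + t)⁻¹`; this expresses the integrand of the power `a ^ p` through `t a (a + t)⁻¹`,
the form treated by `parallel_sum_le`. -/
lemma cfcn_rpowIntegrand_eq (ha : 0 ≤ a) {p t : ℝ} (hp : p ∈ Set.Ioo 0 1) (ht : 0 < t) :
    ∃ v : F →L[ℂ] F, (∀ g, a (v g) + (t : ℂ) • v g = g) ∧
      cfcₙ (Real.rpowIntegrand₀₁ p t) a = t ^ (p - 1) • (a * v) := by
  have hspec : spectrum ℝ a ⊆ Set.Ici 0 := fun x hx => spectrum_nonneg_of_nonneg ha hx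
  have hne : ∀ x ∈ spectrum ℝ a, t + x ≠ 0 := fun x hx => by
    have : 0 ≤ x := hspec hx
    positivity
  have hsa : IsSelfAdjoint a := IsSelfAdjoint.of_nonneg ha
  have hcont : ContinuousOn (fun x : ℝ => (t + x)⁻¹) (spectrum ℝ a) :=
    ContinuousOn.inv₀ (by fun_prop) hne
  refine ⟨cfc (fun x : ℝ => (t + x)⁻¹) a, fun g => ?_, ?_⟩
  · have h1 : (a + algebraMap ℝ _ t) * cfc (fun x : ℝ => (t + x)⁻¹) a = 1 := by
      rw [← cfc_id' ℝ a, ← cfc_add_const t (fun x => x) a, cfc_id' ℝ a,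
        ← cfc_mul _ _ a (by fun_prop) hcont, ← cfc_one ℝ a]
      refine cfc_congr fun x hx => ?_
      have := hne x hx
      simp only [Pi.one_apply]
      rw [add_comm x]
      exact mul_inv_cancel₀ this
    have h2 := congrArg (fun T : F →L[ℂ] F => T g) h1
    simpa [Algebra.algebraMap_eq_smul_one, mul_apply_eq_comp] using h2
  · rw [cfcₙ_eq_cfc ((Real.continuousOn_rpowIntegrand₀₁_Ici hp ht).mono ?_) (by simp)]
    · have : t ^ (p - 1) • (a * cfc (fun x : ℝ => (t + x)⁻¹) a) =
          cfc (fun x : ℝ => t ^ (p - 1) • (x * (t + x)⁻¹)) a := by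
        rw [cfc_smul (t ^ (p - 1)) (fun x : ℝ => x * (t + x)⁻¹) a (by fun_prop),
          cfc_mul (fun x => x) _ a (by fun_prop) hcont, cfc_id' ℝ a]
      rw [this]
      refine cfc_congr fun x hx => ?_
      simp only [smul_eq_mul]
      rw [Real.rpowIntegrand₀₁_eq_pow_div hp ht.le (hspec hx)]
      ring
    · rw [quasispectrum_eq_spectrum_union_zero]
      rintro x (hx | rfl)
      exacts [hspec hx, Set.self_mem_Ici]

/-- A Löwner–Heinz–Hansen inequality: for a contraction `S`, `S* a S ≤ b` passes to powers in `(0,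
1)`. The integral representation of the power reduces it to each `t > 0`, where the quadratic form
of `t a (a + t)⁻¹` is the minimum over `k` of `⟨k, a k⟩ + t ‖g - k‖²`. -/
lemma re_inner_rpow_le (ha : 0 ≤ a) (hb : 0 ≤ b) {S : F →L[ℂ] F} (hS : ‖S‖ ≤ 1)
    (h : ∀ f, (inner ℂ (S f) (a (S f))).re ≤ (inner ℂ f (b f)).re) {s : ℝ}
    (hs : s ∈ Set.Ioo 0 1) (f : F) :
    (inner ℂ (S f) ((a ^ s) (S f))).re ≤ (inner ℂ f ((b ^ s) f)).re := by
  lift s to NNReal using hs.1.le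
  have hs' : s ∈ Set.Ioo (0 : NNReal) 1 := by exact_mod_cast hs
  obtain ⟨μ, hμ⟩ := CFC.exists_measure_nnrpow_eq_integral_cfcₙ_rpowIntegrand₀₁
    (A := F →L[ℂ] F) hs'
  obtain ⟨ha1, ha2⟩ := hμ a ha
  obtain ⟨hb1, hb2⟩ := hμ b hb
  rw [← CFC.nnrpow_eq_rpow hs'.1, ← CFC.nnrpow_eq_rpow hs'.1, ha2, hb2]
  let φ : F → (F →L[ℂ] F) →L[ℝ] ℝ := fun g =>
    Complex.reCLM ∘L ((innerSL ℂ g ∘L ContinuousLinearMap.apply ℂ F g).restrictScalars ℝ)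
  change φ (S f) _ ≤ φ f _
  rw [← ContinuousLinearMap.integral_comp_comm _ ha1,
    ← ContinuousLinearMap.integral_comp_comm _ hb1]
  refine MeasureTheory.setIntegral_mono_on ((φ (S f)).integrable_comp ha1)
    ((φ f).integrable_comp hb1) measurableSet_Ioi fun t ht => ?_
  have ht : 0 < t := ht
  obtain ⟨v, hv, hv'⟩ := cfcn_rpowIntegrand_eq ha hs ht
  obtain ⟨u, hu, hu'⟩ := cfcn_rpowIntegrand_eq hb hs ht
  rw [hv', hu', map_smul, map_smul]
  refine smul_le_smul_of_nonneg_left ?_ (by positivity)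
  change (inner ℂ (S f) (a (v (S f)))).re ≤ (inner ℂ f (b (u f))).re
  -- The competitor for `a` at `S f` is the image under `S` of the minimizer `t u f` for `b` at `f`.
  have h1 := parallel_sum_le ha ht (v (S f)) (S ((t : ℂ) • u f))
  have h2 := parallel_sum_eq b t (u f)
  rw [hv] at h1
  rw [hu] at h2
  have h3 := h ((t : ℂ) • u f)
  have h4 : ‖S f - S ((t : ℂ) • u f)‖ ≤ ‖f - (t : ℂ) • u f‖ := by
    rw [← map_sub]
    exact S.le_of_opNorm_le hS _ |>.trans_eq (one_mul _)
  have h5 : t * ‖S f - S ((t : ℂ) • u f)‖ ^ 2 ≤ t * ‖f - (t : ℂ) • u f‖ ^ 2 := by gcongr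
  exact le_of_mul_le_mul_left (by linarith) ht

/-- Interpolation: an operator that is bounded on `F` and between the ranges of `a ^ (1 / 2)` and
`b ^ (1 / 2)` is bounded between the ranges of `a ^ (s / 2)` and `b ^ (s / 2)`. -/
lemma exists_interpolation (ha : 0 ≤ a) (hb : 0 ≤ b) (hinj : Function.Injective b)
    {T C : F →L[ℂ] F} (hC : T ∘L (a ^ (1 / 2 : ℝ)) = (b ^ (1 / 2 : ℝ)) ∘L C) {s : ℝ}
    (hs : s ∈ Set.Icc (0 : ℝ) 1) :
    ∃ D : F →L[ℂ] F, T ∘L (a ^ (s / 2)) = (b ^ (s / 2)) ∘L D := by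
  rcases hs.1.eq_or_lt with rfl | hs0
  · refine ⟨T, ?_⟩
    rw [zero_div, CFC.rpow_zero a, CFC.rpow_zero b]
    rfl
  rcases hs.2.eq_or_lt with rfl | hs1
  · exact ⟨C, hC⟩
  -- Dividing `T*` by `m` gives both hypotheses of `re_inner_rpow_le`: `‖T‖ ≤ m` for the
  -- contraction, `‖C‖ ≤ m` for the form inequality.
  set m : ℝ := ‖T‖ + ‖C‖ + 1
  have hm : 0 < m := by positivity
  have hmT : ‖T‖ ≤ m := by have := norm_nonneg C; simp only [m]; linarith
  have hmC : ‖C‖ ≤ m := by have := norm_nonneg T; simp only [m]; linarith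
  set S : F →L[ℂ] F := ((m⁻¹ : ℝ) : ℂ) • ContinuousLinearMap.adjoint T with hSdef
  have hnm : ‖((m⁻¹ : ℝ) : ℂ)‖ = m⁻¹ := by
    rw [Complex.norm_real, Real.norm_of_nonneg (by positivity)]
  have hS : ‖S‖ ≤ 1 := by
    rw [hSdef, norm_smul, hnm, LinearIsometryEquiv.norm_map, inv_mul_le_one₀ hm]
    exact hmT
  have hadj : (a ^ (1 / 2 : ℝ)) ∘L ContinuousLinearMap.adjoint T =
      ContinuousLinearMap.adjoint C ∘L (b ^ (1 / 2 : ℝ)) := by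
    have := congrArg ContinuousLinearMap.adjoint hC
    rwa [ContinuousLinearMap.adjoint_comp, ContinuousLinearMap.adjoint_comp, adjoint_rpow,
      adjoint_rpow] at this
  have h1 : ∀ f, (inner ℂ (S f) (a (S f))).re ≤ (inner ℂ f (b f)).re := by
    intro f
    have e1 := re_inner_rpow a zero_le_one (S f)
    have e2 := re_inner_rpow b zero_le_one f
    rw [CFC.rpow_one _] at e1 e2
    rw [e1, e2]
    gcongr
    have e3 := congrArg (fun T : F →L[ℂ] F => T f) hadj
    simp only [ContinuousLinearMap.comp_apply] at e3
    rw [hSdef, smul_apply, map_smul, e3, norm_smul, hnm, inv_mul_le_iff₀ hm]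
    refine (ContinuousLinearMap.le_opNorm _ _).trans ?_
    rw [LinearIsometryEquiv.norm_map]
    gcongr
  have h2 : ∀ f, ‖((a ^ (s / 2)) ∘L S) f‖ ≤ 1 * ‖(b ^ (s / 2)) f‖ := by
    intro f
    have := re_inner_rpow_le ha hb hS h1 ⟨hs0, hs1⟩ f
    rw [re_inner_rpow a hs0.le, re_inner_rpow b hs0.le] at this
    rw [one_mul]
    exact abs_le_of_sq_le_sq' this (norm_nonneg _) |>.2
  have hinj2 : Function.Injective (b ^ (s / 2)) := rpow_injective hb hinj (by linarith)
  obtain ⟨D, hD⟩ := exists_factor_of_norm_le hinj2 (by rwa [adjoint_rpow]) h2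
  rw [adjoint_rpow] at hD
  refine ⟨(m : ℂ) • D, ?_⟩
  rw [ContinuousLinearMap.comp_smul, ← hD, ContinuousLinearMap.adjoint_comp, adjoint_rpow, hSdef,
    LinearIsometryEquiv.map_smulₛₗ, ContinuousLinearMap.adjoint_adjoint, Complex.conj_ofReal,
    ContinuousLinearMap.smul_comp, smul_smul]
  rw [← Complex.ofReal_mul, mul_inv_cancel₀ hm.ne', Complex.ofReal_one, one_smul]

end Powers

/-! ### The operator `(L² + 1)⁻¹` -/

section InvSq

variable {L : F →ₗ.[ℂ] F}

lemma I_mem_resolventSet (hL : IsSelfAdjoint L) : Complex.I ∈ resolventSet L :=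
  mem_resolventSet_of_im_ne_zero hL (by simp)

lemma invSqAddOne_nonneg (L : F →ₗ.[ℂ] F) : 0 ≤ invSqAddOne L :=
  star_mul_self_nonneg (res L Complex.I)

lemma adjoint_res_injective (hL : IsSelfAdjoint L) {z : ℂ} (hz : z ∈ resolventSet L) :
    Function.Injective (ContinuousLinearMap.adjoint (res L z)) :=
  res_conj hL hz ▸ res_injective (conj_mem_resolventSet hL hz)

lemma invSqAddOne_rpow_injective (hL : IsSelfAdjoint L) {s : ℝ} (hs : 0 ≤ s) :
    Function.Injective (invSqAddOne L ^ s) :=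
  rpow_injective (invSqAddOne_nonneg L)
    ((adjoint_res_injective hL (I_mem_resolventSet hL)).comp
      (res_injective (I_mem_resolventSet hL))) hs

lemma norm_sqrt_invSqAddOne_apply (L : F →ₗ.[ℂ] F) (f : F) :
    ‖(invSqAddOne L ^ (1 / 2 : ℝ)) f‖ = ‖res L Complex.I f‖ := by
  have h := re_inner_rpow (invSqAddOne L) zero_le_one f
  rw [CFC.rpow_one _ (invSqAddOne_nonneg L), invSqAddOne, ContinuousLinearMap.comp_apply,
    ContinuousLinearMap.adjoint_inner_right, inner_self_eq_norm_sq_to_K] at h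
  rw [← sq_eq_sq₀ (norm_nonneg _) (norm_nonneg _), invSqAddOne, ← h]
  simp [← Complex.ofReal_pow]

/-- The square root is the modulus `|R_i|`, and `‖|R_i| f‖ = ‖R_i f‖`. Douglas's lemma in both
directions gives `|R_i|` and `R_i* = R_{-i}` the same range, which is `dom(L)`. -/
lemma mem_domain_iff_exists_sqrt (hL : IsSelfAdjoint L) {x : F} :
    x ∈ L.domain ↔ ∃ f, (invSqAddOne L ^ (1 / 2 : ℝ)) f = x := by
  have hI := I_mem_resolventSet hL
  have hinj := invSqAddOne_rpow_injective hL (s := 1 / 2) (by norm_num)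
  constructor
  · intro hx
    obtain ⟨C, hC⟩ := exists_factor_of_norm_le (P := invSqAddOne L ^ (1 / 2 : ℝ))
      (S := res L Complex.I) (c := 1) hinj (by rwa [adjoint_rpow]) fun f => by
        rw [norm_sqrt_invSqAddOne_apply, one_mul]
    obtain ⟨f, hf⟩ := exists_res_eq (conj_mem_resolventSet hL hI) hx
    rw [res_conj hL hI, hC, adjoint_rpow] at hf
    exact ⟨C f, hf⟩
  · rintro ⟨f, rfl⟩
    obtain ⟨C, hC⟩ := exists_factor_of_norm_le (S := invSqAddOne L ^ (1 / 2 : ℝ))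
      (P := res L Complex.I) (c := 1) (res_injective hI) (adjoint_res_injective hL hI) fun f => by
        rw [norm_sqrt_invSqAddOne_apply, one_mul]
    rw [adjoint_rpow, ← res_conj hL hI] at hC
    rw [hC]
    exact res_mem_domain (conj_mem_resolventSet hL hI) _

lemma exists_sqrt_factor (hL : IsSelfAdjoint L) {T : F →L[ℂ] F} (hT : ∀ f, T f ∈ L.domain) :
    ∃ C : F →L[ℂ] F, T = (invSqAddOne L ^ (1 / 2 : ℝ)) ∘L C :=
  exists_factor_of_range_le (invSqAddOne_rpow_injective hL (by norm_num))
    fun f => (mem_domain_iff_exists_sqrt hL).1 (hT f)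

/-- An operator that maps into `dom(L)` maps into `H_s` for `s ≤ 1`. -/
lemma exists_rpow_factor (hL : IsSelfAdjoint L) {T : F →L[ℂ] F} (hT : ∀ f, T f ∈ L.domain)
    {s : ℝ} (hs : s ∈ Set.Icc (0 : ℝ) 1) :
    ∃ C : F →L[ℂ] F, T = (invSqAddOne L ^ (s / 2)) ∘L C := by
  obtain ⟨C, hC⟩ := exists_sqrt_factor hL hT
  refine ⟨(invSqAddOne L ^ ((1 - s) / 2)) ∘L C, ?_⟩
  rw [← ContinuousLinearMap.comp_assoc]
  change T = (invSqAddOne L ^ (s / 2) * invSqAddOne L ^ ((1 - s) / 2)) ∘L C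
  rw [← rpow_add_of_nonneg _ (by linarith [hs.1]) (by linarith [hs.2]), hC]
  congr 2
  ring

/-- An operator that maps `dom(L)` into `dom(M)` maps `H_s(L)` into `H_s(M)`. -/
lemma exists_rpow_intertwine {M : F →ₗ.[ℂ] F} (hL : IsSelfAdjoint L) (hM : IsSelfAdjoint M)
    {T : F →L[ℂ] F} (hT : ∀ x ∈ L.domain, T x ∈ M.domain) {s : ℝ} (hs : s ∈ Set.Icc (0 : ℝ) 1) :
    ∃ C : F →L[ℂ] F, T ∘L (invSqAddOne L ^ (s / 2)) = (invSqAddOne M ^ (s / 2)) ∘L C := by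
  obtain ⟨C, hC⟩ := exists_sqrt_factor hM (T := T ∘L (invSqAddOne L ^ (1 / 2 : ℝ)))
    fun f => hT _ ((mem_domain_iff_exists_sqrt hL).2 ⟨f, rfl⟩)
  refine exists_interpolation (invSqAddOne_nonneg L) (invSqAddOne_nonneg M) ?_ hC hs
  have h := invSqAddOne_rpow_injective hM zero_le_one
  rwa [CFC.rpow_one _ (invSqAddOne_nonneg M)] at h

lemma commute_res_rpow (hL : IsSelfAdjoint L) {z : ℂ} (hz : z ∈ resolventSet L) (s : ℝ) :
    Commute (invSqAddOne L ^ s) (res L z) := by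
  have hI := I_mem_resolventSet hL
  have h : Commute (invSqAddOne L) (res L z) := by
    have h1 := res_commute (conj_mem_resolventSet hL hI) hz
    rw [res_conj hL hI] at h1
    exact h1.mul_left (res_commute hI hz)
  exact h.cfc_nnreal _

/-- The resolvent factors as `(L² + 1)^{-1/4} W (L² + 1)^{-1/4}` with `W` bounded. -/
lemma exists_res_eq_sandwich (hL : IsSelfAdjoint L) {z : ℂ} (hz : z ∈ resolventSet L) :
    ∃ W : F →L[ℂ] F, res L z =
      (invSqAddOne L ^ (1 / 2 / 2 : ℝ)) ∘L W ∘L (invSqAddOne L ^ (1 / 2 / 2 : ℝ)) := by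
  set q := invSqAddOne L ^ (1 / 2 / 2 : ℝ) with hq
  obtain ⟨C, hC⟩ := exists_sqrt_factor hL (res_mem_domain hz)
  have hqq : invSqAddOne L ^ (1 / 2 : ℝ) = q * q := by
    rw [hq, ← rpow_add_of_nonneg _ (by norm_num) (by norm_num), add_halves]
  -- From `R_z = q q C` and `q R_z = R_z q`, cancel the injective factor `q q`.
  have hcomm : C * q = q * C := by
    have h1 : q * res L z = res L z * q := commute_res_rpow hL hz _
    have h2 : (q * q) * (C * q) = (q * q) * (q * C) := by
      rw [hqq] at hC
      change res L z = (q * q) * C at hC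
      rw [hC] at h1
      simp only [mul_assoc] at h1 ⊢
      exact h1.symm
    rw [← hqq] at h2
    ext f
    exact invSqAddOne_rpow_injective hL (by norm_num)
      (congrArg (fun T : F →L[ℂ] F => T f) h2)
  refine ⟨C, ?_⟩
  rw [hC, hqq]
  change (q * q) * C = q * (C * q)
  rw [hcomm, mul_assoc]

end InvSq

/-! ### The scale of Hilbert spaces -/

section Scale

variable {L : F →ₗ.[ℂ] F} {s : ℝ}

lemma mem_scalePower_graph (hL : IsSelfAdjoint L) (hs : 0 ≤ s) {x f : F} :
    (x, f) ∈ (scalePower L s).graph ↔ (invSqAddOne L ^ (s / 2)) f = x := by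
  have hinj := invSqAddOne_rpow_injective hL (s := s / 2) (by linarith)
  have hker : LinearMap.ker (full (invSqAddOne L ^ (s / 2))).toFun = ⊥ := by
    refine (LinearMap.ker_eq_bot').2 fun y hy => Subtype.ext (hinj ?_)
    rw [ZeroMemClass.coe_zero, map_zero]
    exact hy
  rw [scalePower, LinearPMap.inverse_graph hker]
  constructor
  · rintro ⟨⟨u, v⟩, huv, he⟩
    obtain ⟨y, h1, h2⟩ := (LinearPMap.mem_graph_iff _).1 huv
    obtain ⟨rfl, rfl⟩ : v = x ∧ u = f := by simpa using he
    simp only at h1 h2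
    rw [← h1, ← h2]
    rfl
  · rintro rfl
    exact ⟨(f, _), (full (invSqAddOne L ^ (s / 2))).mem_graph ⟨f, trivial⟩, rfl⟩

/-- `(L² + 1)^{-s/2}` is a bounded bijection from `F` onto `H_s`. -/
lemma exists_scale_equiv (hL : IsSelfAdjoint L) (hs : 0 ≤ s) :
    ∃ (J : F →L[ℂ] Scale L s) (U : Scale L s →L[ℂ] F),
      (∀ f, Scale.incl L s (J f) = (invSqAddOne L ^ (s / 2)) f) ∧
      ∀ x, (invSqAddOne L ^ (s / 2)) (U x) = Scale.incl L s x := by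
  let J₀ : F →ₗ[ℂ] Scale L s :=
    ((invSqAddOne L ^ (s / 2) : F →L[ℂ] F) : F →ₗ[ℂ] F).codRestrict (scalePower L s).domain
      fun f => LinearPMap.mem_domain_of_mem_graph ((mem_scalePower_graph hL hs).2 rfl)
  have hU : ∀ x, (invSqAddOne L ^ (s / 2)) (Scale.pow L s x) = Scale.incl L s x := fun x =>
    (mem_scalePower_graph hL hs).1 ((scalePower L s).mem_graph x)
  have hJ : ∀ f, Scale.pow L s (J₀ f) = f := fun f =>
    invSqAddOne_rpow_injective hL (by linarith) (hU (J₀ f))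
  exact ⟨J₀.mkContinuous 1 fun f => by
      rw [one_mul]; exact (congrArg norm (hJ f)).le,
    (Scale.pow L s).mkContinuous 1 fun x => by rw [one_mul]; rfl, fun f => rfl, hU⟩

/-- The bounded operator `x ↦ (f x, g x)` into a Hilbert sum. -/
def pair {X Y Z : Type*} [SeminormedAddCommGroup X] [NormedSpace ℂ X] [SeminormedAddCommGroup Y]
    [NormedSpace ℂ Y] [SeminormedAddCommGroup Z] [NormedSpace ℂ Z]
    (f : X →L[ℂ] Y) (g : X →L[ℂ] Z) : X →L[ℂ] WithLp 2 (Y × Z) :=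
  (WithLp.prodContinuousLinearEquiv 2 ℂ Y Z).symm.toContinuousLinearMap ∘L f.prod g

/-- The bounded operator `(x, y) ↦ f x + g y` on a Hilbert sum. -/
def copair {X Y Z : Type*} [SeminormedAddCommGroup X] [NormedSpace ℂ X] [SeminormedAddCommGroup Y]
    [NormedSpace ℂ Y] [SeminormedAddCommGroup Z] [NormedSpace ℂ Z]
    (f : X →L[ℂ] Z) (g : Y →L[ℂ] Z) : WithLp 2 (X × Y) →L[ℂ] Z :=
  (f.coprod g) ∘L (WithLp.prodContinuousLinearEquiv 2 ℂ X Y).toContinuousLinearMap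

/-- Boundedness on `H_s` becomes an intertwining relation on `F` after transport by `(L² +
1)^{-s/2}`. -/
lemma memB_incl_incl (hL : IsSelfAdjoint L) (hs : 0 ≤ s) {T C : F →L[ℂ] F}
    (h : T ∘L (invSqAddOne L ^ (s / 2)) = (invSqAddOne L ^ (s / 2)) ∘L C) :
    MemB (Scale.incl L s) (Scale.incl L s) T := by
  obtain ⟨J, U, hJ, hU⟩ := exists_scale_equiv hL hs
  refine ⟨J ∘L C ∘L U, fun x => ?_⟩
  rw [← hU x]
  exact (hJ _).trans (congrArg (fun T : F →L[ℂ] F => T (U x)) h).symm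

lemma memB_inclLeft_incl (hL : IsSelfAdjoint L) (hs : 0 ≤ s) {a b C D : F →L[ℂ] F}
    (ha : a ∘L (invSqAddOne L ^ (s / 2)) = (invSqAddOne L ^ (s / 2)) ∘L C)
    (hb : b = (invSqAddOne L ^ (s / 2)) ∘L D) :
    MemB (inclLeft L s) (Scale.incl L s) (copair a b) := by
  obtain ⟨J, U, hJ, hU⟩ := exists_scale_equiv hL hs
  refine ⟨copair (J ∘L C ∘L U) (J ∘L D), fun x => ?_⟩
  change Scale.incl L s (J (C (U x.fst)) + J (D x.snd)) = a (Scale.incl L s x.fst) + b x.snd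
  rw [map_add, hJ, hJ, ← hU, hb]
  exact congrArg (· + _) (congrArg (fun T : F →L[ℂ] F => T (U x.fst)) ha).symm

lemma memB_id_inclRight {X : Type*} [NormedAddCommGroup X] [NormedSpace ℂ X]
    (hL : IsSelfAdjoint L) (hs : 0 ≤ s) {a b D : X →L[ℂ] F}
    (hb : b = (invSqAddOne L ^ (s / 2)) ∘L D) :
    MemB (LinearMap.id : X →ₗ[ℂ] X) (inclRight L s) (pair a b) := by
  obtain ⟨J, U, hJ, hU⟩ := exists_scale_equiv hL hs
  refine ⟨pair a (J ∘L D), fun x => ?_⟩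
  change WithLp.toLp 2 (a x, Scale.incl L s (J (D x))) = WithLp.toLp 2 (a x, b x)
  rw [hJ, hb]
  rfl

/-- Only the second component must land in `H_s`, so only the lower row is constrained. -/
lemma memB_block_inclLeft_inclRight (hL : IsSelfAdjoint L) (hs : 0 ≤ s)
    {a b c d C D : F →L[ℂ] F}
    (hc : c ∘L (invSqAddOne L ^ (s / 2)) = (invSqAddOne L ^ (s / 2)) ∘L C)
    (hd : d = (invSqAddOne L ^ (s / 2)) ∘L D) :
    MemB (inclLeft L s) (inclRight L s) (block a b c d) := by
  obtain ⟨J, U, hJ, hU⟩ := exists_scale_equiv hL hs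
  refine ⟨pair (copair (a ∘L (invSqAddOne L ^ (s / 2)) ∘L U) b)
    (copair (J ∘L C ∘L U) (J ∘L D)), fun x => ?_⟩
  change WithLp.toLp 2 (a ((invSqAddOne L ^ (s / 2)) (U x.fst)) + b x.snd,
      Scale.incl L s (J (C (U x.fst)) + J (D x.snd))) =
    WithLp.toLp 2 (a (Scale.incl L s x.fst) + b x.snd, c (Scale.incl L s x.fst) + d x.snd)
  rw [map_add, hJ, hJ, ← hU, hd]
  exact congrArg (fun y => WithLp.toLp 2 (_, y + _))
    (congrArg (fun T : F →L[ℂ] F => T (U x.fst)) hc).symm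

lemma memB_block_inclRight_inclLeft (hL : IsSelfAdjoint L) (hs : 0 ≤ s)
    {a b c d C D : F →L[ℂ] F} (ha : a = (invSqAddOne L ^ (s / 2)) ∘L C)
    (hb : b ∘L (invSqAddOne L ^ (s / 2)) = (invSqAddOne L ^ (s / 2)) ∘L D) :
    MemB (inclRight L s) (inclLeft L s) (block a b c d) := by
  obtain ⟨J, U, hJ, hU⟩ := exists_scale_equiv hL hs
  refine ⟨pair (copair (J ∘L C) (J ∘L D ∘L U))
    (copair c (d ∘L (invSqAddOne L ^ (s / 2)) ∘L U)), fun x => ?_⟩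
  change WithLp.toLp 2 (Scale.incl L s (J (C x.fst) + J (D (U x.snd))),
      c x.fst + d ((invSqAddOne L ^ (s / 2)) (U x.snd))) =
    WithLp.toLp 2 (a x.fst + b (Scale.incl L s x.snd), c x.fst + d (Scale.incl L s x.snd))
  rw [map_add, hJ, hJ, ← hU, ha]
  exact congrArg (fun y => WithLp.toLp 2 (_ + y, _))
    (congrArg (fun T : F →L[ℂ] F => T (U x.snd)) hb).symm

end Scale

/-! ### Products with a partially defined operator -/

section Product

variable {V W X : Type*} [NormedAddCommGroup V] [NormedSpace ℂ V] [NormedAddCommGroup W]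
  [NormedSpace ℂ W] [SeminormedAddCommGroup X] [NormedSpace ℂ X]

lemma IsProduct.unique {A : V →ₗ.[ℂ] W} {T : X →L[ℂ] V} {S S' : X →L[ℂ] W}
    (h : IsProduct A T S) (h' : IsProduct A T S') : S = S' := by
  ext f
  exact A.mem_graph_snd_inj (h f) (h' f) rfl

lemma IsProduct.isProduct_product {A : V →ₗ.[ℂ] W} {T : X →L[ℂ] V} {S : X →L[ℂ] W}
    (h : IsProduct A T S) : IsProduct A T (product A T) := by
  have h' : ∃ S : X →L[ℂ] W, IsProduct A T S := ⟨S, h⟩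
  rw [product, dif_pos h']
  exact h'.choose_spec

lemma IsProduct.product_eq {A : V →ₗ.[ℂ] W} {T : X →L[ℂ] V} {S : X →L[ℂ] W}
    (h : IsProduct A T S) : product A T = S :=
  h.isProduct_product.unique h

lemma IsProduct.double {A : F →ₗ.[ℂ] F} {T S : X →L[ℂ] F} (h : IsProduct A T S) :
    IsProduct (double A) T (pair S T) := by
  intro f
  obtain ⟨ψ, h1, h2⟩ := (LinearPMap.mem_graph_iff A).1 (h f)
  refine (LinearPMap.mem_graph_iff _).2 ⟨ψ, h1, ?_⟩
  simp only at h1 h2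
  change WithLp.toLp 2 (A ψ, (ψ : F)) = WithLp.toLp 2 (S f, T f)
  rw [h1, h2]

end Product

section ProductAlgebra

variable {V W X Y : Type*} [NormedAddCommGroup V] [NormedSpace ℂ V] [NormedAddCommGroup W]
  [NormedSpace ℂ W] [SeminormedAddCommGroup X] [NormedSpace ℂ X]
  [SeminormedAddCommGroup Y] [NormedSpace ℂ Y] {A : V →ₗ.[ℂ] W} {T T' : X →L[ℂ] V}
  {S S' : X →L[ℂ] W}

lemma IsProduct.comp (h : IsProduct A T S) (U : Y →L[ℂ] X) : IsProduct A (T ∘L U) (S ∘L U) :=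
  fun f => h (U f)

lemma IsProduct.add (h : IsProduct A T S) (h' : IsProduct A T' S') :
    IsProduct A (T + T') (S + S') := fun f => A.graph.add_mem (h f) (h' f)

lemma IsProduct.sub (h : IsProduct A T S) (h' : IsProduct A T' S') :
    IsProduct A (T - T') (S - S') := fun f => A.graph.sub_mem (h f) (h' f)

lemma IsProduct.smul (h : IsProduct A T S) (c : ℂ) : IsProduct A (c • T) (c • S) :=
  fun f => A.graph.smul_mem c (h f)

lemma IsProduct.copair {T' : Y →L[ℂ] V} {S' : Y →L[ℂ] W} (h : IsProduct A T S)
    (h' : IsProduct A T' S') : IsProduct A (copair T T') (copair S S') :=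
  fun f => A.graph.add_mem (h f.fst) (h' f.snd)

end ProductAlgebra

lemma adjoint_pair (f g : F →L[ℂ] F) : ContinuousLinearMap.adjoint (pair f g) =
    copair (ContinuousLinearMap.adjoint f) (ContinuousLinearMap.adjoint g) := by
  symm
  refine (ContinuousLinearMap.eq_adjoint_iff _ _).2 fun x y => ?_
  change inner ℂ (ContinuousLinearMap.adjoint f x.fst + ContinuousLinearMap.adjoint g x.snd) y =
    inner ℂ x (WithLp.toLp 2 (f y, g y))
  rw [inner_add_left, ContinuousLinearMap.adjoint_inner_left,
    ContinuousLinearMap.adjoint_inner_left, WithLp.prod_inner_apply]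
  rfl

/-! ### Boundedness of `A R_z`, `G_z` and `A R_z A*` -/

section Sandwich

variable {L A : F →ₗ.[ℂ] F} {B : F →L[ℂ] F} {z : ℂ}

/-- If `A (L² + 1)^{-1/4}` is bounded, then so are `A R_z` and `A R_z A*`. -/
lemma exists_sandwich (hL : IsSelfAdjoint L)
    (hB : IsProduct A (invSqAddOne L ^ (1 / 2 / 2 : ℝ)) B) (hz : z ∈ resolventSet L) :
    ∃ W : F →L[ℂ] F,
      IsProduct A (res L z) (B ∘L W ∘L (invSqAddOne L ^ (1 / 2 / 2 : ℝ))) ∧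
      IsProduct A (G L A z) (B ∘L W ∘L ContinuousLinearMap.adjoint B) ∧
      IsProduct A (G L A (conj z))
        (B ∘L ContinuousLinearMap.adjoint W ∘L ContinuousLinearMap.adjoint B) := by
  obtain ⟨W, hW⟩ := exists_res_eq_sandwich hL hz
  set q := invSqAddOne L ^ (1 / 2 / 2 : ℝ) with hq
  have hadj : ContinuousLinearMap.adjoint q = q := adjoint_rpow _ _
  have hW' : res L (conj z) = q ∘L ContinuousLinearMap.adjoint W ∘L q := by
    rw [res_conj hL hz, hW]
    simp only [ContinuousLinearMap.adjoint_comp, hadj, ContinuousLinearMap.comp_assoc]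
  have h1 : IsProduct A (res L z) (B ∘L W ∘L q) := hW ▸ hB.comp (W ∘L q)
  have h2 : IsProduct A (res L (conj z)) (B ∘L ContinuousLinearMap.adjoint W ∘L q) :=
    hW' ▸ hB.comp (ContinuousLinearMap.adjoint W ∘L q)
  have hG : G L A z = q ∘L W ∘L ContinuousLinearMap.adjoint B := by
    rw [G, h2.product_eq]
    simp only [ContinuousLinearMap.adjoint_comp, ContinuousLinearMap.adjoint_adjoint, hadj,
      ContinuousLinearMap.comp_assoc]
  have hG' : G L A (conj z) =
      q ∘L ContinuousLinearMap.adjoint W ∘L ContinuousLinearMap.adjoint B := by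
    rw [G, Complex.conj_conj, h1.product_eq]
    simp only [ContinuousLinearMap.adjoint_comp, hadj, ContinuousLinearMap.comp_assoc]
  exact ⟨W, h1, hG ▸ hB.comp _, hG' ▸ hB.comp _⟩

variable (hL : IsSelfAdjoint L) (hB : IsProduct A (invSqAddOne L ^ (1 / 2 / 2 : ℝ)) B)
  (hz : z ∈ resolventSet L)

include hL hB hz

lemma isProduct_res : IsProduct A (res L z) (product A (res L z)) := by
  obtain ⟨W, h, -⟩ := exists_sandwich hL hB hz
  exact h.isProduct_product

lemma isProduct_G : IsProduct A (G L A z) (product A (G L A z)) := by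
  obtain ⟨W, -, h, -⟩ := exists_sandwich hL hB hz
  exact h.isProduct_product

/-- In sandwich form the two products are `B W* B*` and `B W B*`. -/
lemma adjoint_product_G : ContinuousLinearMap.adjoint (product A (G L A (conj z))) =
    product A (G L A z) := by
  obtain ⟨W, -, h, h'⟩ := exists_sandwich hL hB hz
  rw [h.product_eq, h'.product_eq]
  simp only [ContinuousLinearMap.adjoint_comp, ContinuousLinearMap.adjoint_adjoint,
    ContinuousLinearMap.comp_assoc]

/-- This justifies reading `G_z` as the bounded extension of `R_z A*`. -/
lemma G_apply_of_mem_adjoint_graph (hA : Dense (A.domain : Set F)) {x y : F}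
    (h : (x, y) ∈ A.adjoint.graph) : G L A z x = res L z y := by
  refine ext_inner_left ℂ fun f => ?_
  have hz' := conj_mem_resolventSet hL hz
  rw [G, ContinuousLinearMap.adjoint_inner_right,
    (mem_adjoint_graph_iff hA).1 h _ _ (isProduct_res hL hB hz' f), res_conj hL hz,
    ContinuousLinearMap.adjoint_inner_left]

lemma GG_eq : GG L A z = copair (G L A z) (res L z) := by
  have hz' := conj_mem_resolventSet hL hz
  rw [GG, (isProduct_res hL hB hz').double.product_eq, adjoint_pair, ← G, res_conj hL hz,
    ContinuousLinearMap.adjoint_adjoint]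

lemma adjoint_GG_conj : ContinuousLinearMap.adjoint (GG L A (conj z)) =
    pair (product A (res L z)) (res L z) := by
  rw [GG, ContinuousLinearMap.adjoint_adjoint, Complex.conj_conj,
    (isProduct_res hL hB hz).double.product_eq]

lemma isProduct_GG : IsProduct A (GG L A z) (copair (product A (G L A z)) (product A (res L z))) :=
  GG_eq hL hB hz ▸ (isProduct_G hL hB hz).copair (isProduct_res hL hB hz)

/-- By the first resolvent identity and adjunction, the difference is a multiple of `R_z G_w`, so
the outer resolvent supplies the regularity. -/
lemma G_sub_G_mem_domain {w : ℂ} (hw : w ∈ resolventSet L) (f : F) :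
    (G L A w - G L A z) f ∈ L.domain := by
  have hz' := conj_mem_resolventSet hL hz
  have hw' := conj_mem_resolventSet hL hw
  have h1 := (isProduct_res hL hB hw').sub (isProduct_res hL hB hz')
  rw [res_sub_res hw' hz'] at h1
  have h2 := h1.unique (((isProduct_res hL hB hw').comp (res L (conj z))).smul _)
  have h3 := congrArg ContinuousLinearMap.adjoint h2
  rw [map_sub, ← G, ← G, LinearIsometryEquiv.map_smulₛₗ, ContinuousLinearMap.adjoint_comp,
    res_conj hL hz, ContinuousLinearMap.adjoint_adjoint] at h3
  rw [h3]
  exact L.domain.smul_mem _ (res_mem_domain hz _)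

end Sandwich

/-! ### Block operator matrices -/

lemma block_eq (a b c d : F →L[ℂ] F) : block a b c d = pair (copair a b) (copair c d) := rfl

lemma block_mul (a b c d a' b' c' d' : F →L[ℂ] F) :
    block a b c d ∘L block a' b' c' d' =
      block (a * a' + b * c') (a * b' + b * d') (c * a' + d * c') (c * b' + d * d') := by
  ext x
  change WithLp.toLp 2 (a (a' x.fst + b' x.snd) + b (c' x.fst + d' x.snd),
      c (a' x.fst + b' x.snd) + d (c' x.fst + d' x.snd)) =
    WithLp.toLp 2 ((a (a' x.fst) + b (c' x.fst)) + (a (b' x.snd) + b (d' x.snd)),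
      (c (a' x.fst) + d (c' x.fst)) + (c (b' x.snd) + d (d' x.snd)))
  simp only [map_add]
  congr 2 <;> abel

lemma block_one : block (1 : F →L[ℂ] F) 0 0 1 = 1 := by
  ext x
  change WithLp.toLp 2 (x.fst + 0, 0 + x.snd) = x
  rw [add_zero, zero_add]
  rfl

lemma block_add (a b c d a' b' c' d' : F →L[ℂ] F) :
    block a b c d + block a' b' c' d' = block (a + a') (b + b') (c + c') (d + d') := by
  ext x
  change WithLp.toLp 2 (a x.fst + b x.snd, c x.fst + d x.snd) +
      WithLp.toLp 2 (a' x.fst + b' x.snd, c' x.fst + d' x.snd) =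
    WithLp.toLp 2 ((a x.fst + a' x.fst) + (b x.snd + b' x.snd),
      (c x.fst + c' x.fst) + (d x.snd + d' x.snd))
  rw [← WithLp.toLp_add, Prod.mk_add_mk]
  congr 2 <;> abel

lemma copair_sub (a b a' b' : F →L[ℂ] F) :
    copair a b - copair a' b' = copair (a - a') (b - b') := by
  ext x
  change (a x.fst + b x.snd) - (a' x.fst + b' x.snd) = (a x.fst - a' x.fst) + (b x.snd - b' x.snd)
  abel

lemma copair_block_pair (g r a b c d u v : F →L[ℂ] F) :
    copair g r ∘L block a b c d ∘L pair u v =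
      g * (a * u + b * v) + r * (c * u + d * v) := by
  ext x
  rfl

/-- The algebra behind the resolvent formula: the inverse of a block operator matrix. -/
lemma block_inverse {R G a g Q L α γ E : F →L[ℂ] F}
    (h₁ : Q = R + G * Q + R * α - R * E * Q)
    (h₂ : Q = R + L * R + Q * a - Q * E * R)
    (h₃ : α = a + g * Q + a * α - a * E * Q)
    (h₄ : α = a + γ * R + α * a - α * E * R)
    (h₅ : L = G + Q * g + L * G - Q * E * G)
    (h₆ : L = G + R * γ + G * L - R * E * L)
    (h₇ : γ = g + α * g + γ * G - α * E * G)
    (h₈ : γ = g + a * γ + g * L - a * E * L) :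
    block Q (1 - Q * E + L) (1 + α - E * Q) (γ - E - α * E + E * Q * E - E * L) ∘L
        block (E - g) (1 - a) (1 - G) (-R) = 1 ∧
      block (E - g) (1 - a) (1 - G) (-R) ∘L
        block Q (1 - Q * E + L) (1 + α - E * Q) (γ - E - α * E + E * Q * E - E * L) = 1 ∧
      Q = R + copair G R ∘L
        block Q (1 - Q * E + L) (1 + α - E * Q) (γ - E - α * E + E * Q * E - E * L) ∘L
          pair a R := by
  -- The `-E` in `C` explains the correction terms: the lower row of `K` brings in `E` times a
  -- relation from the left, its second column a relation times `E` from the right.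
  refine ⟨?_, ?_, ?_⟩
  · rw [block_mul, ← block_one]
    congr 1
    · linear_combination (norm := noncomm_ring) h₅
    · linear_combination (norm := noncomm_ring) h₂
    · linear_combination (norm := noncomm_ring) h₇ - E * h₅
    · linear_combination (norm := noncomm_ring) h₄ - E * h₂
  · rw [block_mul, ← block_one]
    congr 1
    · linear_combination (norm := noncomm_ring) h₃
    · linear_combination (norm := noncomm_ring) h₈ - h₃ * E
    · linear_combination (norm := noncomm_ring) h₁
    · linear_combination (norm := noncomm_ring) h₆ - h₁ * E
  · rw [copair_block_pair]
    linear_combination (norm := noncomm_ring) h₁ + G * h₂ + R * (h₄ - E * h₂)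

/-! ### Perturbed resolvents -/

section Perturbation

variable {H M A : F →ₗ.[ℂ] F} {E B C : F →L[ℂ] F} {z : ℂ}

/-- `M` is the operator `H + A* + A - E` with domain `dom(H)`. -/
structure IsPerturbation (H A : F →ₗ.[ℂ] F) (E : F →L[ℂ] F) (M : F →ₗ.[ℂ] F) : Prop where
  domain_eq : M.domain = H.domain
  exists_mem_graph : ∀ x y, (x, y) ∈ H.graph → ∃ u v, (x, u) ∈ A.adjoint.graph ∧
    (x, v) ∈ A.graph ∧ (x, y + u + v - E x) ∈ M.graph

variable (hH : IsSelfAdjoint H) (hM : IsSelfAdjoint M) (hP : IsPerturbation H A E M)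
  (hA : Dense (A.domain : Set F))
  (hB : IsProduct A (invSqAddOne H ^ (1 / 2 / 2 : ℝ)) B)
  (hC : IsProduct A (invSqAddOne M ^ (1 / 2 / 2 : ℝ)) C)
  (hE : ContinuousLinearMap.adjoint E = E)
  (hz : z ∈ resolventSet H) (hz' : z ∈ resolventSet M)

include hH hM hP hA hB hC hz hz'

/-- Second resolvent identity: `(z - H) Q f = f + (A* + A - E) Q f`; apply `R_z` and replace `R_z
A*` by `G_z`. -/
lemma res_perturbation_left : res M z = res H z + G H A z * res M z +
    res H z * product A (res M z) - res H z * E * res M z := by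
  ext f
  have h1 := res_mem_graph hz' f
  obtain ⟨y, hy⟩ := LinearPMap.mem_domain_iff.1 (hP.domain_eq ▸ res_mem_domain hz' f)
  obtain ⟨u, v, hu, hv, hw⟩ := hP.exists_mem_graph _ _ hy
  have h2 := M.mem_graph_snd_inj h1 hw rfl
  have h3 := A.mem_graph_snd_inj hv (isProduct_res hM hC hz' f) rfl
  have h4 := res_sub hz hy
  have h5 : z • res M z f - y = f + u + v - E (res M z f) := by
    rw [sub_eq_iff_eq_add] at h2 ⊢
    rw [h2]; abel
  rw [h5, map_sub, map_add, map_add, ← G_apply_of_mem_adjoint_graph hH hB hz hA hu, h3] at h4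
  exact h4.symm

lemma res_perturbation_right : res M z = res H z + G M A z * res H z +
    res M z * product A (res H z) - res M z * E * res H z := by
  ext f
  have hy := res_mem_graph hz f
  obtain ⟨u, v, hu, hv, hw⟩ := hP.exists_mem_graph _ _ hy
  have h3 := A.mem_graph_snd_inj hv (isProduct_res hH hB hz f) rfl
  have h4 := res_sub hz' hw
  have h5 : z • res H z f - (z • res H z f - f + u + v - E (res H z f)) =
      f - u - v + E (res H z f) := by abel
  rw [h5, map_add, map_sub, map_sub, ← G_apply_of_mem_adjoint_graph hM hC hz' hA hu, h3] at h4
  change res M z f = res H z f + G M A z (res H z f) + res M z (product A (res H z) f) -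
    res M z (E (res H z f))
  rw [← sub_eq_zero] at h4 ⊢
  refine Eq.trans ?_ h4
  abel

/-- Apply `A` to `res_perturbation_left`; each term on the right maps into `dom(A)` with bounded
product. -/
lemma product_res_perturbation_left : product A (res M z) = product A (res H z) +
    product A (G H A z) * res M z + product A (res H z) * product A (res M z) -
      product A (res H z) * E * res M z := by
  have h := isProduct_res hM hC hz'
  have hR := isProduct_res hH hB hz
  refine h.unique ?_
  nth_rewrite 1 [res_perturbation_left hH hM hP hA hB hC hz hz']
  exact ((hR.add ((isProduct_G hH hB hz).comp _)).add (hR.comp _)).sub ((hR.comp E).comp _)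

lemma product_res_perturbation_right : product A (res M z) = product A (res H z) +
    product A (G M A z) * res H z + product A (res M z) * product A (res H z) -
      product A (res M z) * E * res H z := by
  have h := isProduct_res hM hC hz'
  have hR := isProduct_res hH hB hz
  refine h.unique ?_
  nth_rewrite 1 [res_perturbation_right hH hM hP hA hB hC hz hz']
  exact ((hR.add ((isProduct_G hM hC hz').comp _)).add (h.comp _)).sub ((h.comp E).comp _)

include hE

/-- Adjoint of `product_res_perturbation_left` at `conj z`; reversing the factors exchanges left and
right. -/
lemma G_perturbation_right : G M A z = G H A z + res M z * product A (G H A z) +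
    G M A z * G H A z - res M z * E * G H A z := by
  have h := congrArg ContinuousLinearMap.adjoint (product_res_perturbation_left hH hM hP hA hB hC
    (conj_mem_resolventSet hH hz) (conj_mem_resolventSet hM hz'))
  simp only [map_sub, map_add, ContinuousLinearMap.mul_def, ContinuousLinearMap.adjoint_comp, hE,
    adjoint_product_G hH hB hz, res_conj hM hz', ContinuousLinearMap.adjoint_adjoint] at h
  rw [← res_conj hM hz'] at h
  exact h

lemma G_perturbation_left : G M A z = G H A z + res H z * product A (G M A z) +
    G H A z * G M A z - res H z * E * G M A z := by
  have h := congrArg ContinuousLinearMap.adjoint (product_res_perturbation_right hH hM hP hA hB hC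
    (conj_mem_resolventSet hH hz) (conj_mem_resolventSet hM hz'))
  simp only [map_sub, map_add, ContinuousLinearMap.mul_def, ContinuousLinearMap.adjoint_comp, hE,
    adjoint_product_G hM hC hz', res_conj hH hz, ContinuousLinearMap.adjoint_adjoint] at h
  rw [← res_conj hH hz] at h
  exact h

lemma product_G_perturbation_right : product A (G M A z) = product A (G H A z) +
    product A (res M z) * product A (G H A z) + product A (G M A z) * G H A z -
      product A (res M z) * E * G H A z := by
  have h := isProduct_G hM hC hz'
  have hQ := isProduct_res hM hC hz'
  refine h.unique ?_
  nth_rewrite 1 [G_perturbation_right hH hM hP hA hB hC hE hz hz']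
  exact (((isProduct_G hH hB hz).add (hQ.comp _)).add (h.comp _)).sub ((hQ.comp E).comp _)

lemma product_G_perturbation_left : product A (G M A z) = product A (G H A z) +
    product A (res H z) * product A (G M A z) + product A (G H A z) * G M A z -
      product A (res H z) * E * G M A z := by
  have h := isProduct_G hH hB hz
  have hR := isProduct_res hH hB hz
  refine (isProduct_G hM hC hz').unique ?_
  nth_rewrite 1 [G_perturbation_left hH hM hP hA hB hC hE hz hz']
  exact ((h.add (hR.comp _)).add (h.comp _)).sub ((hR.comp E).comp _)

/-- The resolvent formula, with the inverse of the block operator matrix given explicitly. -/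
lemma resolvent_formula :
    ∃ K, K = block (res M z) (1 - res M z * E + G M A z) (1 + product A (res M z) - E * res M z)
        (product A (G M A z) - E - product A (res M z) * E + E * res M z * E - E * G M A z) ∧
      K ∘L block (E - product A (G H A z)) (1 - product A (res H z)) (1 - G H A z) (-res H z) = 1 ∧
      block (E - product A (G H A z)) (1 - product A (res H z)) (1 - G H A z) (-res H z) ∘L K = 1 ∧
      res M z = res H z + GG H A z ∘L K ∘L ContinuousLinearMap.adjoint (GG H A (conj z)) := by
  rw [GG_eq hH hB hz, adjoint_GG_conj hH hB hz]
  exact ⟨_, rfl, block_inverse (res_perturbation_left hH hM hP hA hB hC hz hz')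
    (res_perturbation_right hH hM hP hA hB hC hz hz')
    (product_res_perturbation_left hH hM hP hA hB hC hz hz')
    (product_res_perturbation_right hH hM hP hA hB hC hz hz')
    (G_perturbation_right hH hM hP hA hB hC hE hz hz')
    (G_perturbation_left hH hM hP hA hB hC hE hz hz')
    (product_G_perturbation_right hH hM hP hA hB hC hE hz hz')
    (product_G_perturbation_left hH hM hP hA hB hC hE hz hz')⟩

end Perturbation

/-! ### Sums of partially defined operators -/

section Sums

variable {S T : F →ₗ.[ℂ] F} {x y w : F}

lemma add_mem_graph (hS : (x, y) ∈ S.graph) (hT : (x, w) ∈ T.graph) :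
    (x, y + w) ∈ (S + T).graph := by
  obtain ⟨⟨_, h₁⟩, rfl, rfl⟩ := (LinearPMap.mem_graph_iff S).1 hS
  obtain ⟨⟨_, h₂⟩, rfl, rfl⟩ := (LinearPMap.mem_graph_iff T).1 hT
  exact (LinearPMap.mem_graph_iff _).2 ⟨⟨_, h₁, h₂⟩, rfl, rfl⟩

lemma exists_of_mem_add_graph (h : (x, y) ∈ (S + T).graph) :
    ∃ u v, (x, u) ∈ S.graph ∧ (x, v) ∈ T.graph ∧ u + v = y := by
  obtain ⟨⟨_, h₁, h₂⟩, rfl, rfl⟩ := (LinearPMap.mem_graph_iff _).1 h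
  exact ⟨_, _, S.mem_graph ⟨_, h₁⟩, T.mem_graph ⟨_, h₂⟩, rfl⟩

lemma mem_sub_full_graph {E : F →L[ℂ] F} :
    (x, y) ∈ (S - full E).graph ↔ (x, y + E x) ∈ S.graph := by
  constructor
  · intro h
    obtain ⟨⟨_, h₁, h₂⟩, rfl, rfl⟩ := (LinearPMap.mem_graph_iff _).1 h
    refine (LinearPMap.mem_graph_iff _).2 ⟨⟨_, h₁⟩, rfl, ?_⟩
    exact (sub_add_cancel (S ⟨_, h₁⟩) (E _)).symm
  · intro h
    obtain ⟨⟨_, h₁⟩, rfl, h₂⟩ := (LinearPMap.mem_graph_iff _).1 h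
    refine (LinearPMap.mem_graph_iff _).2 ⟨⟨_, h₁, trivial⟩, rfl, ?_⟩
    exact sub_eq_of_eq_add h₂

end Sums

/-! ### Self-adjointness of the perturbed operators -/

section Perturbation

variable {H A : F →ₗ.[ℂ] F} {E : F →L[ℂ] F}

lemma domain_add_adjoint_add (hsmall : IsSmall H (A.adjoint + A)) :
    (H + A.adjoint + A).domain = H.domain := by
  obtain ⟨hd, -⟩ := hsmall
  exact le_antisymm (fun x hx => hx.1.1) fun x hx => ⟨⟨hx, (hd hx).1⟩, (hd hx).2⟩

lemma dense_domain_of_isSmall (hH : IsSelfAdjoint H) (hsmall : IsSmall H (A.adjoint + A)) :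
    Dense (A.domain : Set F) := by
  obtain ⟨hd, -⟩ := hsmall
  exact hH.dense_domain.mono fun x hx => (hd hx).2

/-- The sum is symmetric because moving `A` across the inner product produces `A*` and conversely;
smallness is the Kato–Rellich bound. -/
lemma isSelfAdjoint_add_adjoint_add (hH : IsSelfAdjoint H)
    (hsmall : IsSmall H (A.adjoint + A)) : IsSelfAdjoint (H + A.adjoint + A) := by
  have hA := dense_domain_of_isSmall hH hsmall
  have hdom := domain_add_adjoint_add hsmall
  obtain ⟨hd, a, b, ha₀, ha, hab⟩ := hsmall
  refine isSelfAdjoint_of_relatively_bounded hH hdom ?_ ha₀ ha (b := b) ?_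
  · intro x y u v hxy huv
    obtain ⟨_, y₃, hy, hy₃, rfl⟩ := exists_of_mem_add_graph hxy
    obtain ⟨y₁, y₂, hy₁, hy₂, rfl⟩ := exists_of_mem_add_graph hy
    obtain ⟨_, v₃, hv, hv₃, rfl⟩ := exists_of_mem_add_graph huv
    obtain ⟨v₁, v₂, hv₁, hv₂, rfl⟩ := exists_of_mem_add_graph hv
    have e1 := (mem_graph_iff_of_isSelfAdjoint hH).1 hy₁ _ _ hv₁
    have e2 := (mem_adjoint_graph_iff hA).1 hy₂ _ _ hv₃
    have e3 := congrArg (starRingEnd ℂ) ((mem_adjoint_graph_iff hA).1 hv₂ _ _ hy₃)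
    rw [inner_conj_symm, inner_conj_symm] at e3
    simp only [inner_add_left, inner_add_right, e1, e2, e3]
    ring
  · intro x y y' hy hy'
    obtain ⟨_, w, hyu, hw, rfl⟩ := exists_of_mem_add_graph hy'
    obtain ⟨y₁, u, hy₁, hu, rfl⟩ := exists_of_mem_add_graph hyu
    obtain ⟨⟨x, hx⟩, rfl, rfl⟩ := (LinearPMap.mem_graph_iff H).1 hy
    obtain rfl := H.mem_graph_snd_inj hy hy₁ rfl
    have h := (A.adjoint + A).mem_graph_snd_inj (add_mem_graph hu hw)
      ((A.adjoint + A).mem_graph ⟨x, hd hx⟩) rfl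
    have h2 := hab ⟨x, hx⟩
    rw [← h] at h2
    rwa [add_assoc, add_sub_cancel_left]

lemma isSelfAdjoint_sub_full {L : F →ₗ.[ℂ] F} (hL : IsSelfAdjoint L)
    (hE : (E : F →ₗ[ℂ] F).IsSymmetric) : IsSelfAdjoint (L - full E) := by
  refine isSelfAdjoint_of_relatively_bounded hL (inf_top_eq _) ?_ le_rfl zero_lt_one (b := ‖E‖) ?_
  · intro x y u v hxy huv
    have h1 := (mem_graph_iff_of_isSelfAdjoint hL).1 (mem_sub_full_graph.1 hxy) _ _
      (mem_sub_full_graph.1 huv)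
    have h2 : inner ℂ (E u) x = inner ℂ u (E x) := hE u x
    rwa [inner_add_left, inner_add_right, h2, add_left_inj] at h1
  · intro x y y' hy hy'
    rw [L.mem_graph_snd_inj hy (mem_sub_full_graph.1 hy') rfl, sub_add_cancel_left, norm_neg,
      zero_mul, zero_add]
    exact E.le_opNorm x

lemma isPerturbation (hsmall : IsSmall H (A.adjoint + A)) :
    IsPerturbation H A E (H + A.adjoint + A - full E) where
  domain_eq := (inf_top_eq _).trans (domain_add_adjoint_add hsmall)
  exists_mem_graph x y h := by
    obtain ⟨hd, -⟩ := hsmall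
    have hx := hd (LinearPMap.mem_domain_of_mem_graph h)
    have hu := A.adjoint.mem_graph ⟨x, hx.1⟩
    have hv := A.mem_graph ⟨x, hx.2⟩
    refine ⟨_, _, hu, hv, mem_sub_full_graph.2 ?_⟩
    rw [sub_add_cancel]
    exact add_mem_graph (add_mem_graph h hu) hv

end Perturbation

/-! ### Mapping properties -/

section Mapping

variable {H M A : F →ₗ.[ℂ] F} {E B : F →L[ℂ] F} {z : ℂ}

lemma exists_isProduct_rpow (hH : IsSelfAdjoint H)
    (hA : PMemB (Scale.incl H (1 / 2)) (LinearMap.id : F →ₗ[ℂ] F) A) :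
    ∃ B : F →L[ℂ] F, IsProduct A (invSqAddOne H ^ (1 / 2 / 2 : ℝ)) B := by
  obtain ⟨S, hS⟩ := hA
  obtain ⟨J, U, hJ, -⟩ := exists_scale_equiv hH (s := 1 / 2) (by norm_num)
  exact ⟨S ∘L J, fun f => hJ f ▸ hS (J f)⟩

/-- Interpolating the identity, which maps `dom(M)` into `dom(H)`, gives `(M² + 1)^{-1/4} = (H² +
1)^{-1/4} D` with `D` bounded. -/
lemma exists_isProduct_rpow_of_domain_eq (hH : IsSelfAdjoint H) (hM : IsSelfAdjoint M)
    (hdom : M.domain = H.domain) (hB : IsProduct A (invSqAddOne H ^ (1 / 2 / 2 : ℝ)) B) :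
    ∃ C : F →L[ℂ] F, IsProduct A (invSqAddOne M ^ (1 / 2 / 2 : ℝ)) C := by
  obtain ⟨D, hD⟩ := exists_rpow_intertwine hM hH (T := 1) (fun x hx => hdom ▸ hx)
    (s := 1 / 2) ⟨by norm_num, by norm_num⟩
  refine ⟨B ∘L D, ?_⟩
  have : invSqAddOne M ^ (1 / 2 / 2 : ℝ) = (invSqAddOne H ^ (1 / 2 / 2 : ℝ)) ∘L D := hD
  rw [this]
  exact hB.comp D

lemma pMemB_double (hH : IsSelfAdjoint H)
    (hB : IsProduct A (invSqAddOne H ^ (1 / 2 / 2 : ℝ)) B) :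
    PMemB (Scale.incl H 1) (inclRight H 1) (double A) := by
  obtain ⟨J, U, -, hU⟩ := exists_scale_equiv hH zero_le_one
  set q := invSqAddOne H ^ (1 / 2 / 2 : ℝ) with hq
  have hqq : invSqAddOne H ^ (1 / 2 : ℝ) = q ∘L q := by
    change _ = q * q
    rw [hq, ← rpow_add_of_nonneg _ (by norm_num) (by norm_num), add_halves]
  refine ⟨pair (B ∘L q ∘L U) (ContinuousLinearMap.id ℂ _), fun x => ?_⟩
  have h := (hB.comp q).double (U x)
  rw [← hqq] at h
  change ((invSqAddOne H ^ (1 / 2 : ℝ)) (U x),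
      WithLp.toLp 2 (B (q (U x)), (invSqAddOne H ^ (1 / 2 : ℝ)) (U x))) ∈
    (double A).graph at h
  rw [hU] at h
  exact h

/-- `G_z` maps the domain of `A*` into the domain of the self-adjoint operator. -/
lemma G_mem_domain (hM : IsSelfAdjoint M) (hB : IsProduct A (invSqAddOne M ^ (1 / 2 / 2 : ℝ)) B)
    (hz : z ∈ resolventSet M) (hA : Dense (A.domain : Set F)) {x : F}
    (hx : x ∈ A.adjoint.domain) : G M A z x ∈ M.domain := by
  obtain ⟨u, hu⟩ := LinearPMap.mem_domain_iff.1 hx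
  rw [G_apply_of_mem_adjoint_graph hM hB hz hA hu]
  exact res_mem_domain hz u

lemma Theta_eq (H A : F →ₗ.[ℂ] F) (E : F →L[ℂ] F) (l : ℝ) :
    Theta H A E l = block (E - product A (G H A l)) (1 - product A (res H l)) (1 - G H A l)
      (-res H l) := by
  rw [Theta, ARA, G, ContinuousLinearMap.adjoint_adjoint, Complex.conj_ofReal]

lemma isProduct_MM (hH : IsSelfAdjoint H) (hB : IsProduct A (invSqAddOne H ^ (1 / 2 / 2 : ℝ)) B)
    {l : ℝ} (hl : (l : ℂ) ∈ resolventSet H) (hz : z ∈ resolventSet H) :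
    IsProduct (double A) (GG H A l - GG H A z)
      (block (product A (G H A l) - product A (G H A z)) (product A (res H l) - product A (res H z))
        (G H A l - G H A z) (res H l - res H z)) := by
  have h := ((isProduct_GG hH hB hl).sub (isProduct_GG hH hB hz)).double
  rw [GG_eq hH hB hl, GG_eq hH hB hz] at h ⊢
  rw [copair_sub, copair_sub] at h
  rwa [copair_sub]

/-- The terms at `l` cancel: the sum is `Θ` with `l` replaced by `z`. -/
lemma Theta_add_MM_eq (hH : IsSelfAdjoint H)
    (hB : IsProduct A (invSqAddOne H ^ (1 / 2 / 2 : ℝ)) B)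
    {l : ℝ} (hl : (l : ℂ) ∈ resolventSet H) (hz : z ∈ resolventSet H) :
    Theta H A E l + MM H A l z = block (E - product A (G H A z)) (1 - product A (res H z))
      (1 - G H A z) (-res H z) := by
  rw [MM, (isProduct_MM hH hB hl hz).product_eq, Theta_eq, block_add]
  congr 1 <;> abel

lemma memB_MM (hH : IsSelfAdjoint H) (hB : IsProduct A (invSqAddOne H ^ (1 / 2 / 2 : ℝ)) B)
    {l : ℝ} (hl : (l : ℂ) ∈ resolventSet H) (hz : z ∈ resolventSet H) :
    MemB (LinearMap.id : WithLp 2 (F × F) →ₗ[ℂ] WithLp 2 (F × F)) (inclRight H 1)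
      (MM H A l z) := by
  rw [MM, (isProduct_MM hH hB hl hz).product_eq, block_eq]
  obtain ⟨C, hC⟩ := exists_rpow_factor hH (fun f => G_sub_G_mem_domain hH hB hz hl f)
    ⟨zero_le_one, le_rfl⟩
  obtain ⟨D, hD⟩ := exists_rpow_factor hH (T := res H l - res H z)
    (fun f => H.domain.sub_mem (res_mem_domain hl f) (res_mem_domain hz f)) ⟨zero_le_one, le_rfl⟩
  refine memB_id_inclRight hH zero_le_one (D := copair C D) ?_
  rw [hC, hD]
  ext x
  exact (map_add (invSqAddOne H ^ (1 / 2 : ℝ)) _ _).symm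

/-- `1 - G_z` preserves `dom(H)`, hence each `H_s` by interpolation, and `R_z` maps `F` into
`dom(H)`. The upper row lands in `F` and may be arbitrary. -/
lemma memB_block (hH : IsSelfAdjoint H) (hB : IsProduct A (invSqAddOne H ^ (1 / 2 / 2 : ℝ)) B)
    (hA : Dense (A.domain : Set F)) (hd : H.domain ≤ A.adjoint.domain)
    (hz : z ∈ resolventSet H) (a b : F →L[ℂ] F) {s : ℝ} (hs : s ∈ Set.Icc (0 : ℝ) 1) :
    MemB (inclLeft H s) (inclRight H s) (block a b (1 - G H A z) (-res H z)) := by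
  obtain ⟨C, hC⟩ := exists_rpow_intertwine hH hH (T := 1 - G H A z)
    (fun x hx => H.domain.sub_mem hx (G_mem_domain hH hB hz hA (hd hx))) hs
  obtain ⟨D, hD⟩ := exists_rpow_factor hH (T := -res H z)
    (fun f => H.domain.neg_mem (res_mem_domain hz f)) hs
  exact memB_block_inclLeft_inclRight hH hs.1 hC hD

end Mapping

end Krein

end

/-! ### The main theorem -/

open Krein ComplexConjugate in
theorem lemma4p1 {F : Type*} [NormedAddCommGroup F] [InnerProductSpace ℂ F] [CompleteSpace F]
    -- a self-adjoint operator, bounded from below, and a real point below its spectrum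
    (H : F →ₗ.[ℂ] F) (hH : IsSelfAdjoint H) (hb : BoundedFromBelow H)
    (l : ℝ) (hl : (l : EReal) < infSpectrum H)
    -- a closable operator in `B(H_{1/2}, F)` such that `A* + A` is `H`-small
    (A : F →ₗ.[ℂ] F) (hA : A.IsClosable)
    (hA2 : PMemB (Scale.incl H (1 / 2)) (LinearMap.id : F →ₗ[ℂ] F) A)
    (hsmall : IsSmall H (A.adjoint + A))
    -- a bounded symmetric operator
    (E : F →L[ℂ] F) (hE : (E : F →ₗ[ℂ] F).IsSymmetric) :
    -- `H + A* + A` is self-adjoint on `dom(H)`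
    (H + A.adjoint + A).domain = H.domain ∧ IsSelfAdjoint (H + A.adjoint + A) ∧
    -- the operators are well defined and bounded between the stated spaces
    PMemB (Scale.incl H 1) (inclRight H 1) (double A) ∧
    IsProduct A (G H A l) (ARA H A l) ∧
    (∀ s ∈ Set.Icc (0 : ℝ) 1, MemB (inclLeft H s) (inclRight H s) (Theta H A E l)) ∧
    (∀ z ∈ resolventSet H,
      IsProduct A (res H (conj z)) (product A (res H (conj z))) ∧
      IsProduct (double A) (res H (conj z)) (product (double A) (res H (conj z))) ∧
      IsProduct (double A) (GG H A l - GG H A z) (MM H A l z) ∧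
      MemB (LinearMap.id : WithLp 2 (F × F) →ₗ[ℂ] WithLp 2 (F × F)) (inclRight H 1)
        (MM H A l z) ∧
      MemB (LinearMap.id : F →ₗ[ℂ] F) (inclRight H 1)
        (ContinuousLinearMap.adjoint (GG H A (conj z))) ∧
      ∀ s ∈ Set.Icc (0 : ℝ) 1,
        MemB (Scale.incl H s) (Scale.incl H s) (G H A z) ∧
        MemB (inclLeft H s) (Scale.incl H s) (GG H A z)) ∧
    -- the block operator matrix is invertible, and the resolvent formula holds
    (∀ z ∈ resolventSet H ∩ resolventSet (H + A.adjoint + A - full E),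
      ∃ K : WithLp 2 (F × F) →L[ℂ] WithLp 2 (F × F),
        K ∘L (Theta H A E l + MM H A l z) = 1 ∧ (Theta H A E l + MM H A l z) ∘L K = 1 ∧
        (∀ s ∈ Set.Icc (0 : ℝ) 1,
          MemB (inclLeft H s) (inclRight H s) (Theta H A E l + MM H A l z) ∧
          MemB (inclRight H s) (inclLeft H s) K) ∧
        res (H + A.adjoint + A - full E) z =
          res H z + GG H A z ∘L K ∘L ContinuousLinearMap.adjoint (GG H A (conj z))) := by
  have hdense := dense_domain_of_isSmall hH hsmall
  have hd : H.domain ≤ A.adjoint.domain := fun x hx => (hsmall.1 hx).1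
  have hlr := mem_resolventSet_of_lt_infSpectrum hl
  obtain ⟨B, hB⟩ := exists_isProduct_rpow hH hA2
  refine ⟨domain_add_adjoint_add hsmall, isSelfAdjoint_add_adjoint_add hH hsmall,
    pMemB_double hH hB, isProduct_G hH hB hlr, fun s hs => ?_, fun z hz => ?_, ?_⟩
  · rw [Theta_eq]
    exact memB_block hH hB hdense hd hlr _ _ hs
  · have hz' := conj_mem_resolventSet hH hz
    refine ⟨isProduct_res hH hB hz', (isProduct_res hH hB hz').double.isProduct_product,
      (isProduct_MM hH hB hlr hz).isProduct_product, memB_MM hH hB hlr hz, ?_, fun s hs => ?_⟩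
    · obtain ⟨D, hD⟩ := exists_rpow_factor hH (res_mem_domain hz) ⟨zero_le_one, le_rfl⟩
      rw [adjoint_GG_conj hH hB hz]
      exact memB_id_inclRight hH zero_le_one hD
    · obtain ⟨C, hC⟩ := exists_rpow_intertwine hH hH (T := G H A z)
        (fun x hx => G_mem_domain hH hB hz hdense (hd hx)) hs
      obtain ⟨D, hD⟩ := exists_rpow_factor hH (res_mem_domain hz) hs
      rw [GG_eq hH hB hz]
      exact ⟨memB_incl_incl hH hs.1 hC, memB_inclLeft_incl hH hs.1 hC hD⟩
  · rintro z ⟨hz, hz'⟩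
    have hM : IsSelfAdjoint (H + A.adjoint + A - full E) :=
      isSelfAdjoint_sub_full (isSelfAdjoint_add_adjoint_add hH hsmall) hE
    have hP := isPerturbation (E := E) hsmall
    obtain ⟨C, hC⟩ := exists_isProduct_rpow_of_domain_eq hH hM hP.domain_eq hB
    have hE' : ContinuousLinearMap.adjoint E = E :=
      (ContinuousLinearMap.isSelfAdjoint_iff_isSymmetric.2 hE).adjoint_eq
    obtain ⟨K, hK, h1, h2, h3⟩ := resolvent_formula hH hM hP hdense hB hC hE' hz hz'
    rw [Theta_add_MM_eq hH hB hlr hz]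
    refine ⟨K, h1, h2, fun s hs => ⟨memB_block hH hB hdense hd hz _ _ hs, ?_⟩, h3⟩
    rw [hK]
    -- Equality of the domains lets the perturbed resolvent be measured in the scale of `H`.
    have hQ : ∀ f, res (H + A.adjoint + A - full E) z f ∈ H.domain := fun f =>
      hP.domain_eq ▸ res_mem_domain hz' f
    obtain ⟨C', hC'⟩ := exists_rpow_factor hH hQ hs
    -- The upper right entry of `K` preserves `dom(H)`: `Q` maps into it, and the perturbed `G_z`
    -- maps `dom(A*) ⊇ dom(H)` into it.
    obtain ⟨D, hD⟩ := exists_rpow_intertwine hH hH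
      (T := 1 - res (H + A.adjoint + A - full E) z * E + G (H + A.adjoint + A - full E) A z)
      (fun x hx => H.domain.add_mem (H.domain.sub_mem hx (hQ _))
        (hP.domain_eq ▸ G_mem_domain hM hC hz' hdense (hd hx))) hs
    exact memB_block_inclRight_inclLeft hH hs.1 hC' hD
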